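/- Setting. There are $n$ users. Each user $u$ independently holds a data set $X^{(u)}$ whose size $m_u \in \mathbb{N}^\star$ is drawn from a known distribution $M$ on $\mathbb{N}^\star$ and which, given $m_u = i$, consists of $i$ i.i.d. samples from an unknown probability measure $\mu$ on $[-1,1]$. An $\alpha$-LDP mechanism $Q=(Q_u)_{u\le n}$ with values in a measurable space $\mathcal{Z}$ draws, one after the other, $Z^{(u)} \sim Q_u(\cdot \mid X^{(u)}, Z^{(1)},\dots,Z^{(u-1)})$, where $Q_u(S \mid x, z) \le e^{\alpha} Q_u(S \mid x', z)$ for all measurable $S$, all data sets $x, x'$ and all previous releases $z$. The minimax risk is $$R_{\alpha,n,M} = \inf_{Q,\hat\theta}\ \sup_{\mu}\ \mathbb{E}\Big[\big|\hat\theta(Z^{(1)},\dots,Z^{(n)}) - \textstyle\int x\,d\mu(x)\big|^2\Big],$$ the infimum being over all $\alpha$-LDP mechanisms $Q$ (and their output spaces) and all measurable estimators $\hat\theta$ with values in $[-1,1]$, and the supremum over all probability measures $\mu$ on $[-1,1]$. Let $c_4 = 8$, $c_5 = 868.5$, and for $a \in \mathbb{N}^\star$ $$\phi(a) = \frac{c_5}{n\alpha^2}\,\log\!\left[\frac{c_4\,(a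 n\alpha^2 \vee 1)}{\log\big(c_4\,(a n\alpha^2 \vee 1)\big)}\right].$$ Statement. There is a universal constant $C>0$ such that the following holds for all $n$, all $0<\alpha\le 22/35$ with $n\alpha^2 \ge 1$, all $m \in \mathbb{N}^\star$ and all $\rho\in[0,1]$, where $M$ is the two-point size distribution that gives mass $\rho$ to $m$ and mass $1-\rho$ to $1$. For every $a\in\mathbb{N}^\star$, $\phi(a) = c_5 (n\alpha^2)^{-1}\log[c_4 a n\alpha^2/\log(c_4 a n\alpha^2)]$, and: 1. in all cases, $R_{\alpha,n,M} \le C\,\dfrac{\log(c_4\, n\alpha^2)}{n\alpha^2}$; 2. if $\rho^2 \ge \phi(m)$, then $R_{\alpha,n,M} \le C\,\dfrac{\log(m n\alpha^2)}{n\alpha^2\,((1-\rho)+\rho\sqrt m)^2}$; 3. for every $a \in \{2,\dots,m-1\}$, if $\rho^2 \in [\phi(a),\phi(a+1))$, then $$R_{\alpha,n,M} \le C\left(\frac{\log(a n\alpha^2)}{n\alpha^2\,((1-\rho)+\rho\sqrt a)^2} \wedge \frac{e^{-\rho^2 n\alpha^2/c_5}}{\rho^2}\right).$$ -/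

import Mathlib

open MeasureTheory ProbabilityTheory
open scoped ENNReal

namespace UserLDP

noncomputable section

/-- The range `[-1, 1]` of the data. -/
abbrev Unit11 : Type := Set.Icc (-1 : ℝ) 1

/-- The possible local data sets of a user: the disjoint union of the `[-1, 1] ^ i`, `i ≥ 1`. -/
abbrev Dataset : Type := Σ i : ℕ+, (Fin (i : ℕ) → Unit11)

/-- The law `ν_μ` of one user's data set: its size `i` is drawn from `M`, and given `i` the samples
are drawn from `μ^{⊗ i}`. -/
def userLaw (M : PMF ℕ+) (μ : Measure Unit11) : Measure Dataset :=
  Measure.sum fun i : ℕ+ =>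
    M i • Measure.map (fun x : Fin (i : ℕ) → Unit11 => (⟨i, x⟩ : Dataset))
      (Measure.pi fun _ => μ)

/-- A sequentially interactive `α`-LDP mechanism for `n` users with output space `Z`: the channel
of user `u` draws `Z^{(u)}` from the user's data set and the releases of the earlier users. -/
structure Mechanism (n : ℕ) (α : ℝ) (Z : Type) [MeasurableSpace Z] where
  channel : (u : Fin n) → Kernel (Dataset × (Fin (u : ℕ) → Z)) Z
  markov : ∀ u, IsMarkovKernel (channel u)
  private_ : ∀ (u : Fin n) (z : Fin (u : ℕ) → Z) (x x' : Dataset) (S : Set Z), MeasurableSet S →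
    channel u (x, z) S ≤ ENNReal.ofReal (Real.exp α) * channel u (x', z) S

section Transcript

variable {n : ℕ} {α : ℝ} {Z : Type} [MeasurableSpace Z]

theorem measurable_snoc (k : ℕ) :
    Measurable fun p : (Fin k → Z) × Z => (Fin.snoc p.1 p.2 : Fin (k + 1) → Z) := by
  rw [measurable_pi_iff]
  intro i
  refine Fin.lastCases ?_ (fun j => ?_) i
  · simpa using measurable_snd
  · simp only [Fin.snoc_castSucc]
    exact (measurable_pi_apply j).comp measurable_fst

/-- The channel of user `k`, as a kernel from all data sets and the first `k` releases. -/
def Mechanism.step (Q : Mechanism n α Z) (k : ℕ) (hk : k < n) :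
    Kernel ((Fin n → Dataset) × (Fin k → Z)) Z :=
  (Q.channel ⟨k, hk⟩).comap (fun p => (p.1 ⟨k, hk⟩, p.2))
    (((measurable_pi_apply _).comp measurable_fst).prodMk measurable_snd)

instance (Q : Mechanism n α Z) (k : ℕ) (hk : k < n) : IsMarkovKernel (Q.step k hk) := by
  have := Q.markov ⟨k, hk⟩
  unfold Mechanism.step
  infer_instance

/-- The conditional law of the first `k` releases given all data sets: the releases are drawn one
after the other from the successive channels. -/
def Mechanism.transcript (Q : Mechanism n α Z) :
    (k : ℕ) → k ≤ n → Kernel (Fin n → Dataset) (Fin k → Z)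
  | 0, _ => Kernel.const _ (Measure.dirac Fin.elim0)
  | k + 1, hk =>
    ((Q.transcript k (Nat.le_of_succ_le hk)) ⊗ₖ (Q.step k hk)).map
      fun p => (Fin.snoc p.1 p.2 : Fin (k + 1) → Z)

instance (Q : Mechanism n α Z) (k : ℕ) (hk : k ≤ n) : IsMarkovKernel (Q.transcript k hk) := by
  induction k with
  | zero => unfold Mechanism.transcript; infer_instance
  | succ k ih =>
    have := ih (Nat.le_of_succ_le hk)
    unfold Mechanism.transcript
    exact Kernel.IsMarkovKernel.map _ (measurable_snoc k)

/-- The law of the `n` releases when the users' data sets are i.i.d. with law `ν`. -/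
def Mechanism.outputLaw (Q : Mechanism n α Z) (ν : Measure Dataset) : Measure (Fin n → Z) :=
  (Measure.pi fun _ : Fin n => ν).bind (Q.transcript n le_rfl)

end Transcript

/-- The minimax risk `R_{α, n, M}`: the infimum over all output spaces, all `α`-LDP mechanisms and
all measurable estimators with values in `[-1, 1]` of the supremum over all probability measures
`μ` on `[-1, 1]` of the mean squared error in estimating the mean of `μ`. -/
def risk (α : ℝ) (n : ℕ) (M : PMF ℕ+) : ℝ≥0∞ :=
  ⨅ (Z : Type) (_ : MeasurableSpace Z) (Q : Mechanism n α Z)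
    (est : (Fin n → Z) → Unit11) (_ : Measurable est),
    ⨆ μ : ProbabilityMeasure Unit11,
      ∫⁻ z, ENNReal.ofReal (|(est z : ℝ) - ∫ x, (x : ℝ) ∂(μ : Measure Unit11)| ^ 2)
        ∂(Q.outputLaw (userLaw M (μ : Measure Unit11)))

/-- The two-point size distribution: size `m` with probability `ρ`, size `1` with
probability `1 - ρ`. -/
def twoPoint (m : ℕ+) (ρ : ℝ) (hρ : ρ ∈ Set.Icc (0 : ℝ) 1) : PMF ℕ+ :=
  ⟨fun k => (if k = 1 then ENNReal.ofReal (1 - ρ) else 0) + (if k = m then ENNReal.ofReal ρ else 0),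
    by
      have h : ENNReal.ofReal (1 - ρ) + ENNReal.ofReal ρ = 1 := by
        rw [← ENNReal.ofReal_add (by linarith [hρ.2]) hρ.1]
        simp
      rw [← h]
      exact (hasSum_ite_eq 1 _).add (hasSum_ite_eq m _)⟩

/-- The universal constant `c₄`. -/
def c4 : ℝ := 8

/-- The universal constant `c₅`. -/
def c5 : ℝ := 868.5

/-- The threshold function `φ`. -/
def phi (n : ℕ) (α : ℝ) (a : ℕ) : ℝ :=
  c5 / (n * α ^ 2) *
    Real.log (c4 * max (a * (n * α ^ 2)) 1 / Real.log (c4 * max (a * (n * α ^ 2)) 1))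

end

end UserLDP

namespace UserLDP

/-! Write N = nα², θ for the mean of μ, and x = 8aN. The mechanisms used ignore earlier releases: a
user with feature vector t releases v ∈ {±1}^d with probability 2^{-d}(1 + Σ t_k v_k). Its mean is
t, and it is α-private as soon as ‖t‖₁ ≤ 0.44α, whatever d is. So (`risk_le_of_features`) the task
is to estimate θ from n i.i.d. sign vectors with mean E t; every coordinate average has variance at
most 1/n, and sparse features in high dimension are free.

With t proportional to the first sample the risk is at most 6/N (`risk_twoPoint_le`). This gives the
general bound, and also the finer rate when ρ√a ≤ 1.

When ρ√a > 1, only data sets with at least a ≥ 2 samples contribute. The mean of their first a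
samples is within w = 2√(log x / a) of θ, up to probability 2/x². Cut [-1,1] into bins of half-width
w. One block of coordinates votes for the bin of the local mean, another records its offset from
nearby centres; ‖t‖₁ stays bounded because one vote and at most three offsets are nonzero. The bin
with most votes is close to θ, and its averaged offset, rescaled by w/(αρ), corrects the centre with
variance of order w²/(Nρ²), that is log x/(aNρ²) (`risk_twoPoint_le_of_bins`).

The condition φ(a) ≤ ρ² says exactly that exp(-ρ²N/c₅) ≤ log x / x (`phi_le_iff`), which makes the
probability of a wrong bin negligible. Its failure at a + 1 reverses the inequality there and turns
the same rate into the exponential bound. -/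

/-- The sign `±1` of a bit. -/
def sgn (b : Bool) : ℝ := if b then 1 else -1

@[simp] theorem sgn_not (b : Bool) : sgn (!b) = -sgn b := by cases b <;> simp [sgn]

theorem sgn_mul_self (b : Bool) : sgn b * sgn b = 1 := by cases b <;> simp [sgn]

theorem abs_sgn (b : Bool) : |sgn b| = 1 := by cases b <;> simp [sgn]

/-! ### Random sign vectors with a prescribed mean, and their privacy -/

section Signs

variable {ι : Type} [Fintype ι] [DecidableEq ι]

/-- Flipping coordinate `k` is an involution that negates every summand. The same flip gives the
orthogonality of distinct coordinates below. -/
theorem sum_sgn (k : ι) : ∑ v : ι → Bool, sgn (v k) = 0 := by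
  have h : ∑ v : ι → Bool, sgn (v k) = ∑ v : ι → Bool, -sgn (v k) := by
    refine Fintype.sum_equiv
      (Function.Involutive.toPerm (fun v : ι → Bool => Function.update v k (!v k)) ?_) _ _ ?_
    · intro v; ext; simp
    · intro v; simp [Function.Involutive.toPerm]
  rw [Finset.sum_neg_distrib] at h
  linarith

theorem sum_sgn_mul_sgn (k l : ι) :
    ∑ v : ι → Bool, sgn (v l) * sgn (v k) = if l = k then 2 ^ Fintype.card ι else 0 := by
  split_ifs with hlk
  · subst hlk
    simp [sgn_mul_self]
  · have h : ∑ v : ι → Bool, sgn (v l) * sgn (v k) = ∑ v : ι → Bool, -(sgn (v l) * sgn (v k)) := by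
      refine Fintype.sum_equiv
        (Function.Involutive.toPerm (fun v : ι → Bool => Function.update v k (!v k)) ?_) _ _ ?_
      · intro v; ext; simp
      · intro v; simp [Function.Involutive.toPerm, hlk]
    rw [Finset.sum_neg_distrib] at h
    linarith

/-- The probability mass function on sign vectors, the mean of which is `t`. -/
noncomputable def signDensity (t : ι → ℝ) (v : ι → Bool) : ℝ :=
  (2 ^ Fintype.card ι)⁻¹ * (1 + ∑ k, t k * sgn (v k))

theorem sum_signDensity (t : ι → ℝ) : ∑ v, signDensity t v = 1 := by
  simp only [signDensity]
  rw [← Finset.mul_sum, Finset.sum_add_distrib, Finset.sum_comm]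
  simp [← Finset.mul_sum, sum_sgn]

theorem sum_signDensity_mul_sgn (t : ι → ℝ) (k : ι) :
    ∑ v, signDensity t v * sgn (v k) = t k := by
  have h : ∀ v : ι → Bool, signDensity t v * sgn (v k) =
      (2 ^ Fintype.card ι)⁻¹ * (sgn (v k) + ∑ l, t l * (sgn (v l) * sgn (v k))) := by
    intro v
    simp only [signDensity]
    rw [mul_assoc, add_mul, one_mul, Finset.sum_mul]
    simp only [mul_assoc]
  simp only [h]
  rw [← Finset.mul_sum, Finset.sum_add_distrib, Finset.sum_comm, sum_sgn]
  simp [← Finset.mul_sum, sum_sgn_mul_sgn]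
  field_simp

end Signs

theorem abs_sum_mul_sgn_le {ι : Type} [Fintype ι] {t : ι → ℝ} {r : ℝ}
    (ht : ∑ k, |t k| ≤ r) (v : ι → Bool) :
    |∑ k, t k * sgn (v k)| ≤ r := by
  refine (Finset.abs_sum_le_sum_abs _ _).trans ?_
  simpa [abs_mul, abs_sgn] using ht

/-- This is where 0.44 and 22/35 meet: up to a common factor, the two sides compare the largest and
smallest sign densities when ‖t‖₁ ≤ 0.44α. Using exp α ≥ 1 + α + α²/2, it remains to see that 0.22α²
≤ 0.12 + 0.06α. -/
theorem one_add_le_exp_mul_one_sub {α : ℝ} (h0 : 0 < α) (h1 : α ≤ 22 / 35) :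
    1 + 0.44 * α ≤ Real.exp α * (1 - 0.44 * α) := by
  have h := Real.quadratic_le_exp_of_nonneg h0.le
  have h2 : 0 ≤ 1 - 0.44 * α := by linarith
  refine le_trans ?_ (mul_le_mul_of_nonneg_right h h2)
  nlinarith [mul_nonneg h0.le (sub_nonneg.2 h1), mul_nonneg (sq_nonneg α) (sub_nonneg.2 h1)]

section SignMechanism

variable {ι : Type} [Fintype ι] {𝒳 : Type*} [MeasurableSpace 𝒳]

theorem signDensity_nonneg {t : ι → ℝ} {r : ℝ} (ht : ∑ k, |t k| ≤ r) (hr : r ≤ 1)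
    (v : ι → Bool) : 0 ≤ signDensity t v := by
  have := abs_le.1 (abs_sum_mul_sgn_le ht v)
  exact mul_nonneg (by positivity) (by linarith [this.1])

theorem signDensity_le {α : ℝ} (h0 : 0 < α) (h1 : α ≤ 22 / 35) {t t' : ι → ℝ}
    (ht : ∑ k, |t k| ≤ 0.44 * α) (ht' : ∑ k, |t' k| ≤ 0.44 * α) (v : ι → Bool) :
    signDensity t v ≤ Real.exp α * signDensity t' v := by
  have h := abs_le.1 (abs_sum_mul_sgn_le ht v)
  have h' := abs_le.1 (abs_sum_mul_sgn_le ht' v)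
  have hα := one_add_le_exp_mul_one_sub h0 h1
  have hm : Real.exp α * (1 - 0.44 * α) ≤ Real.exp α * (1 + ∑ k, t' k * sgn (v k)) :=
    mul_le_mul_of_nonneg_left (by linarith [h'.1]) (Real.exp_nonneg _)
  simp only [signDensity]
  rw [mul_left_comm]
  exact mul_le_mul_of_nonneg_left (by linarith [h.2]) (by positivity)

/-- The kernel that draws a sign vector with mean `t x`. -/
noncomputable def signKernel (t : 𝒳 → ι → ℝ) : Kernel 𝒳 (ι → Bool) :=
  Kernel.withDensity (Kernel.const 𝒳 Measure.count) fun x v => ENNReal.ofReal (signDensity (t x) v)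

variable {t : 𝒳 → ι → ℝ}

theorem measurable_signDensity (ht : Measurable t) (v : ι → Bool) :
    Measurable fun x => signDensity (t x) v := by
  unfold signDensity
  have : ∀ k, Measurable fun x => t x k := fun k => (measurable_pi_apply k).comp ht
  fun_prop

theorem measurable_uncurry_signDensity (ht : Measurable t) :
    Measurable (Function.uncurry fun x v => ENNReal.ofReal (signDensity (t x) v)) :=
  measurable_from_prod_countable_left fun v => (measurable_signDensity ht v).ennreal_ofReal

theorem signKernel_apply (ht : Measurable t) (x : 𝒳) (S : Set (ι → Bool)) :
    signKernel t x S = ∫⁻ v in S, ENNReal.ofReal (signDensity (t x) v) ∂Measure.count := by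
  rw [signKernel, Kernel.withDensity_apply' _ (measurable_uncurry_signDensity ht)]
  simp

theorem signKernel_singleton (ht : Measurable t) (x : 𝒳) (v : ι → Bool) :
    signKernel t x {v} = ENNReal.ofReal (signDensity (t x) v) := by
  rw [signKernel_apply ht]
  simp

theorem isMarkovKernel_signKernel [DecidableEq ι] (ht : Measurable t) (hb : ∀ x, ∑ k, |t x k| ≤ 1) :
    IsMarkovKernel (signKernel t) := by
  refine ⟨fun x => ⟨?_⟩⟩
  rw [signKernel_apply ht]
  simp only [Measure.restrict_univ, lintegral_count, tsum_fintype]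
  rw [← ENNReal.ofReal_sum_of_nonneg fun v _ => signDensity_nonneg (hb x) le_rfl v,
    sum_signDensity, ENNReal.ofReal_one]

theorem signKernel_le {α : ℝ} (h0 : 0 < α) (h1 : α ≤ 22 / 35) (ht : Measurable t)
    (hb : ∀ x, ∑ k, |t x k| ≤ 0.44 * α) (x x' : 𝒳) (S : Set (ι → Bool)) :
    signKernel t x S ≤ ENNReal.ofReal (Real.exp α) * signKernel t x' S := by
  rw [signKernel_apply ht, signKernel_apply ht, ← lintegral_const_mul' _ _ ENNReal.ofReal_ne_top]
  refine lintegral_mono fun v => ?_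
  rw [← ENNReal.ofReal_mul (Real.exp_nonneg _)]
  exact ENNReal.ofReal_le_ofReal (signDensity_le h0 h1 (hb x) (hb x') v)

theorem integral_sgn_bind_signKernel [DecidableEq ι] (ht : Measurable t) (hb : ∀ x, ∑ k, |t x k| ≤ 1)
    (ν : Measure 𝒳) [IsProbabilityMeasure ν] (k : ι) :
    ∫ v, sgn (v k) ∂(ν.bind (signKernel t)) = ∫ x, t x k ∂ν := by
  have hmark := isMarkovKernel_signKernel ht hb
  have hint : ∀ v, Integrable (fun x => signDensity (t x) v) ν := by
    intro v
    refine Integrable.of_mem_Icc 0 1 (measurable_signDensity ht v).aemeasurable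
      (Filter.Eventually.of_forall fun x => ⟨signDensity_nonneg (hb x) le_rfl v, ?_⟩)
    rw [← sum_signDensity (t x)]
    exact Finset.single_le_sum (fun v _ => signDensity_nonneg (hb x) le_rfl v) (Finset.mem_univ v)
  have hreal : ∀ v, (ν.bind (signKernel t)).real {v} = ∫ x, signDensity (t x) v ∂ν := by
    intro v
    rw [Measure.real, Measure.bind_apply (measurableSet_singleton v) (Kernel.aemeasurable _),
      integral_eq_lintegral_of_nonneg_ae
        (Filter.Eventually.of_forall fun x => signDensity_nonneg (hb x) le_rfl v)
        (measurable_signDensity ht v).aestronglyMeasurable]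
    simp only [signKernel_singleton ht]
  rw [integral_fintype (Integrable.of_finite)]
  simp only [hreal, smul_eq_mul, ← integral_mul_const]
  rw [← integral_finsetSum _ fun v _ => (hint v).mul_const _]
  simp only [sum_signDensity_mul_sgn]

/-- The mechanism in which every user, whatever the earlier releases, draws a sign vector with mean
`t x` from their data set `x`. -/
noncomputable def signMechanism [DecidableEq ι] {α : ℝ} (n : ℕ) (h0 : 0 < α) (h1 : α ≤ 22 / 35)
    {t : Dataset → ι → ℝ} (ht : Measurable t) (hb : ∀ x, ∑ k, |t x k| ≤ 0.44 * α) :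
    Mechanism n α (ι → Bool) where
  channel _ := (signKernel t).comap Prod.fst measurable_fst
  markov _ := by
    have := isMarkovKernel_signKernel ht fun x => (hb x).trans (by linarith)
    infer_instance
  private_ _ _ x x' S _ := by
    rw [Kernel.comap_apply, Kernel.comap_apply]
    exact signKernel_le h0 h1 ht hb x x' S

end SignMechanism

/-! ### Product form of the output law, and reduction to i.i.d. sign vectors -/

section ProductLaw

variable {n : ℕ} {α : ℝ} {Z : Type} [MeasurableSpace Z] [MeasurableSingletonClass Z]

theorem transcript_singleton_of_channel_eq (Q : Mechanism n α Z) (κ : Kernel Dataset Z)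
    (hQ : ∀ u, Q.channel u = κ.comap Prod.fst measurable_fst) (k : ℕ) (hk : k ≤ n)
    (X : Fin n → Dataset) (z : Fin k → Z) :
    Q.transcript k hk X {z} = ∏ u, κ (X (Fin.castLE hk u)) {z u} := by
  induction k with
  | zero =>
    have : z = Fin.elim0 := Subsingleton.elim _ _
    subst this
    simp [Mechanism.transcript]
  | succ k ih =>
    have hpre : (fun p : (Fin k → Z) × Z => (Fin.snoc p.1 p.2 : Fin (k + 1) → Z)) ⁻¹' {z} =
        {Fin.init z} ×ˢ {z (Fin.last k)} := by
      ext ⟨p, q⟩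
      simp only [Set.mem_preimage, Set.mem_singleton_iff, Set.mem_prod]
      constructor
      · rintro rfl
        simp
      · rintro ⟨rfl, rfl⟩
        simp
    have hstep : ∀ p : Fin k → Z, Q.step k hk (X, p) = κ (X ⟨k, hk⟩) := by
      intro p
      rw [Mechanism.step, Kernel.comap_apply, hQ, Kernel.comap_apply]
    rw [Mechanism.transcript, Kernel.map_apply' _ (measurable_snoc k) _ (measurableSet_singleton z),
      hpre, Kernel.compProd_apply_prod (measurableSet_singleton _) (measurableSet_singleton _)]
    simp only [hstep, setLIntegral_const, ih, Fin.prod_univ_castSucc]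
    rw [mul_comm]
    rfl

/-- Channels that ignore the past make the transcript a product given the data, and the data sets
are independent. As `Z` is countable, singletons determine the law. -/
theorem outputLaw_of_channel_eq [Countable Z] (Q : Mechanism n α Z)
    (κ : Kernel Dataset Z) [IsMarkovKernel κ]
    (hQ : ∀ u, Q.channel u = κ.comap Prod.fst measurable_fst)
    (ν : Measure Dataset) [IsProbabilityMeasure ν] :
    Q.outputLaw ν = Measure.pi fun _ => ν.bind κ := by
  refine Measure.ext_of_singleton fun z => ?_
  have hm : ∀ u, Measurable fun x => κ x {z u} := fun u =>
    Kernel.measurable_coe κ (measurableSet_singleton _)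
  have hind : iIndepFun (fun (u : Fin n) (X : Fin n → Dataset) => κ (X u) {z u})
      (Measure.pi fun _ => ν) := iIndepFun_pi fun u => (hm u).aemeasurable
  rw [Mechanism.outputLaw, Measure.bind_apply (measurableSet_singleton z) (Kernel.aemeasurable _),
    Measure.pi_singleton]
  simp only [transcript_singleton_of_channel_eq Q κ hQ]
  refine (lintegral_prod_eq_prod_lintegral_of_indepFun Finset.univ _ hind
    fun u => (hm u).comp (measurable_pi_apply u)).trans ?_
  refine Finset.prod_congr rfl fun u _ => ?_
  rw [Measure.bind_apply (measurableSet_singleton _) (Kernel.aemeasurable _)]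
  exact (measurePreserving_eval (fun _ : Fin n => ν) u).lintegral_comp (hm u)

end ProductLaw

theorem measurable_dataset_mk (i : ℕ+) :
    Measurable fun x : Fin (i : ℕ) → Unit11 => (⟨i, x⟩ : Dataset) :=
  measurable_iff_le_map.2 (iInf_le _ i)

instance (M : PMF ℕ+) (μ : Measure Unit11) [IsProbabilityMeasure μ] :
    IsProbabilityMeasure (userLaw M μ) := by
  refine ⟨?_⟩
  rw [userLaw, Measure.sum_apply _ MeasurableSet.univ]
  simp [Measure.map_apply (measurable_dataset_mk _), M.tsum_coe]

/-- To bound the minimax risk it suffices to estimate the mean from `n` independent sign vectors,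
the means of which are those of a feature map with small `ℓ¹` norm. -/
theorem risk_le_of_features {ι : Type} [Fintype ι] {n : ℕ} {α : ℝ} (h0 : 0 < α) (h1 : α ≤ 22 / 35)
    {M : PMF ℕ+} {t : Dataset → ι → ℝ} (ht : Measurable t) (hb : ∀ x, ∑ k, |t x k| ≤ 0.44 * α)
    (est : (Fin n → ι → Bool) → Unit11) {B : ℝ}
    (hB : ∀ (μ : Measure Unit11) [IsProbabilityMeasure μ] (P : Measure (ι → Bool))
      [IsProbabilityMeasure P], (∀ k, ∫ v, sgn (v k) ∂P = ∫ x, t x k ∂(userLaw M μ)) →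
      ∫ z, |(est z : ℝ) - ∫ x, (x : ℝ) ∂μ| ^ 2 ∂(Measure.pi fun _ : Fin n => P) ≤ B) :
    risk α n M ≤ ENNReal.ofReal B := by
  classical
  have hb' : ∀ x, ∑ k, |t x k| ≤ 1 := fun x => (hb x).trans (by linarith)
  have hmark := isMarkovKernel_signKernel ht hb'
  refine iInf_le_of_le (ι → Bool) <| iInf_le_of_le inferInstance <|
    iInf_le_of_le (signMechanism n h0 h1 ht hb) <| iInf_le_of_le est <|
    iInf_le_of_le (measurable_of_finite _) <| iSup_le fun μ => ?_
  rw [outputLaw_of_channel_eq _ (signKernel t) (fun _ => rfl),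
    ← ofReal_integral_eq_lintegral_ofReal Integrable.of_finite
      (Filter.Eventually.of_forall fun _ => sq_nonneg _)]
  exact ENNReal.ofReal_le_ofReal (hB μ _ fun k => integral_sgn_bind_signKernel ht hb' _ k)

/-! ### Concentration of sign averages and of local sample means -/

/-- Two-sided Hoeffding inequality for independent variables with values in `[-1, 1]`. -/
theorem measureReal_abs_sum_ge_le {Ω ι : Type*} [MeasurableSpace Ω] {μ : Measure Ω}
    [IsProbabilityMeasure μ] {X : ι → Ω → ℝ} (hX : ∀ i, Measurable (X i)) (hind : iIndepFun X μ)
    (hb : ∀ i ω, |X i ω| ≤ 1) (s : Finset ι) {ε : ℝ} (hε : 0 ≤ ε) :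
    μ.real {ω | ε ≤ |∑ i ∈ s, (X i ω - μ[X i])|} ≤ 2 * Real.exp (-ε ^ 2 / (2 * s.card)) := by
  -- The variance proxy in Hoeffding's lemma is the squared half-length of the interval.
  have hc : ((‖(1 : ℝ) - (-1)‖₊ / 2) ^ 2 : NNReal) = 1 := by
    ext
    norm_num
  have hsub : ∀ i, HasSubgaussianMGF (fun ω => X i ω - μ[X i]) 1 μ := fun i => by
    rw [← hc]
    exact hasSubgaussianMGF_of_mem_Icc (hX i).aemeasurable
      (Filter.Eventually.of_forall fun ω => abs_le.1 (hb i ω))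
  have hind₁ : iIndepFun (fun i ω => X i ω - μ[X i]) μ :=
    hind.comp (fun i x => x - ∫ ω, X i ω ∂μ) fun i => measurable_id.sub_const _
  have hind₂ : iIndepFun (fun i ω => -(X i ω - μ[X i])) μ :=
    hind.comp (fun i x => -(x - ∫ ω, X i ω ∂μ)) fun i => (measurable_id.sub_const _).neg
  have h₁ := HasSubgaussianMGF.measure_sum_ge_le_of_iIndepFun hind₁ (s := s)
    (fun i _ => hsub i) hε
  have h₂ := HasSubgaussianMGF.measure_sum_ge_le_of_iIndepFun hind₂ (s := s)
    (fun i _ => (hsub i).neg) hε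
  simp only [Finset.sum_const, nsmul_eq_mul, mul_one, NNReal.coe_natCast] at h₁ h₂
  have hsplit : {ω | ε ≤ |∑ i ∈ s, (X i ω - μ[X i])|} ⊆
      {ω | ε ≤ ∑ i ∈ s, (X i ω - μ[X i])} ∪ {ω | ε ≤ ∑ i ∈ s, -(X i ω - μ[X i])} := by
    intro ω hω
    rw [Set.mem_ofPred_eq, le_abs, ← Finset.sum_neg_distrib] at hω
    exact hω
  calc _ ≤ _ := measureReal_mono hsplit
    _ ≤ _ := measureReal_union_le _ _
    _ ≤ _ := by linarith

section Empirical

variable {ι : Type} {n : ℕ}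

/-- The average over the users of coordinate `k` of their sign vectors. -/
noncomputable def signMean (k : ι) (z : Fin n → ι → Bool) : ℝ := (∑ u, sgn (z u k)) / n

theorem signMean_sub (hn : 0 < n) (k : ι) (z : Fin n → ι → Bool) (e : ℝ) :
    signMean k z - e = (∑ u, (sgn (z u k) - e)) / n := by
  have : (n : ℝ) ≠ 0 := by positivity
  rw [signMean, Finset.sum_sub_distrib]
  simp
  field_simp

variable [Fintype ι] (P : Measure (ι → Bool)) [IsProbabilityMeasure P]

theorem integral_sgn_pi (k : ι) (u : Fin n) :
    ∫ z, sgn (z u k) ∂(Measure.pi fun _ : Fin n => P) = ∫ v, sgn (v k) ∂P :=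
  integral_comp_eval (μ := fun _ : Fin n => P) (f := fun v => sgn (v k))
    (measurable_of_finite _).aestronglyMeasurable

theorem measureReal_signMean_ge_le (hn : 0 < n) (k : ι) {τ : ℝ} (hτ : 0 ≤ τ) :
    (Measure.pi fun _ : Fin n => P).real {z | τ ≤ |signMean k z - ∫ v, sgn (v k) ∂P|} ≤
      2 * Real.exp (-(n * τ ^ 2 / 2)) := by
  have hn' : (0 : ℝ) < n := by positivity
  have h := measureReal_abs_sum_ge_le (μ := Measure.pi fun _ : Fin n => P)
    (X := fun (u : Fin n) z => sgn (z u k)) (fun u => measurable_of_finite _)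
    (iIndepFun_pi (X := fun (_ : Fin n) (v : ι → Bool) => sgn (v k))
      fun _ => (measurable_of_finite _).aemeasurable)
    (fun u z => (abs_sgn _).le) Finset.univ (ε := n * τ) (by positivity)
  have hexp : -(n * τ) ^ 2 / (2 * (n : ℝ)) = -(n * τ ^ 2 / 2) := by field_simp
  simp only [integral_sgn_pi, Finset.card_univ, Fintype.card_fin] at h
  rw [hexp] at h
  convert h using 4 with z
  rw [signMean_sub hn, abs_div, abs_of_pos hn', le_div_iff₀ hn', mul_comm]

/-- A sign has variance at most 1 and the users are independent; the coordinates of one user may be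
dependent, and their number does not enter. -/
theorem integral_signMean_sub_sq_le (hn : 0 < n) (k : ι) :
    ∫ z, (signMean k z - ∫ v, sgn (v k) ∂P) ^ 2 ∂(Measure.pi fun _ : Fin n => P) ≤ 1 / n := by
  have hn' : (0 : ℝ) < n := by positivity
  have hmem : MemLp (fun v : ι → Bool => sgn (v k)) 2 P :=
    MemLp.of_bound (measurable_of_finite _).aestronglyMeasurable 1
      (Filter.Eventually.of_forall fun v => by simp [abs_sgn])
  have hvar : Var[fun v : ι → Bool => sgn (v k); P] ≤ 1 := by
    refine (variance_le_expectation_sq (measurable_of_finite _).aestronglyMeasurable).trans ?_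
    simp [pow_two, sgn_mul_self]
  have h := variance_sum_pi (μ := fun _ : Fin n => P) (X := fun _ v => sgn (v k)) fun _ => hmem
  rw [variance_eq_integral (measurable_of_finite _).aemeasurable] at h
  have hmean : ∫ z, (∑ u : Fin n, fun z : Fin n → ι → Bool => sgn (z u k)) z
      ∂(Measure.pi fun _ : Fin n => P) = n * ∫ v, sgn (v k) ∂P := by
    simp only [Finset.sum_apply]
    rw [integral_finsetSum _ fun u _ => Integrable.of_finite]
    simp [integral_sgn_pi]
  rw [hmean] at h
  have heq : ∀ z : Fin n → ι → Bool, (signMean k z - ∫ v, sgn (v k) ∂P) ^ 2 =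
      ((n : ℝ) ^ 2)⁻¹ * ((∑ u : Fin n, fun z : Fin n → ι → Bool => sgn (z u k)) z -
        n * ∫ v, sgn (v k) ∂P) ^ 2 := by
    intro z
    rw [signMean, Finset.sum_apply]
    field_simp
  simp only [heq]
  rw [integral_const_mul, h, Finset.sum_const, Finset.card_univ, Fintype.card_fin, nsmul_eq_mul]
  calc ((n : ℝ) ^ 2)⁻¹ * (n * Var[fun v : ι → Bool => sgn (v k); P])
      ≤ ((n : ℝ) ^ 2)⁻¹ * (n * 1) := by gcongr
    _ = 1 / n := by field_simp

end Empirical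

/-- The average of the first `a` samples of a data set, if it has as many. -/
noncomputable def prefixMean (a : ℕ) (x : Dataset) : ℝ :=
  (∑ j ∈ Finset.univ.filter (fun j : Fin (x.1 : ℕ) => (j : ℕ) < a), (x.2 j : ℝ)) / a

theorem prefixMean_mk (a : ℕ) (i : ℕ+) (x : Fin (i : ℕ) → Unit11) :
    prefixMean a ⟨i, x⟩ =
      (∑ j ∈ Finset.univ.filter (fun j : Fin (i : ℕ) => (j : ℕ) < a), (x j : ℝ)) / a := rfl

theorem measurable_dataset {β : Type*} [MeasurableSpace β] {f : Dataset → β}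
    (hf : ∀ i : ℕ+, Measurable fun x : Fin (i : ℕ) → Unit11 => f ⟨i, x⟩) : Measurable f := by
  intro s hs
  exact MeasurableSpace.measurableSet_iInf.2 fun i => hf i hs

theorem measurable_prefixMean (a : ℕ) : Measurable (prefixMean a) := by
  refine measurable_dataset fun i => ?_
  simp only [prefixMean_mk]
  have h : ∀ j : Fin (i : ℕ), Measurable fun x : Fin (i : ℕ) → Unit11 => (x j : ℝ) := fun j => by
    fun_prop
  exact (Finset.measurable_sum _ fun j _ => h j).div_const _

theorem card_filter_val_lt {a i : ℕ} (h : a ≤ i) :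
    (Finset.univ.filter fun j : Fin i => (j : ℕ) < a).card = a := by
  rw [Fin.card_filter_val_lt, min_eq_right h]

theorem integral_coe_pi (μ : Measure Unit11) [IsProbabilityMeasure μ] {i : ℕ} (u : Fin i) :
    ∫ x : Fin i → Unit11, (x u : ℝ) ∂(Measure.pi fun _ : Fin i => μ) = ∫ y, (y : ℝ) ∂μ :=
  integral_comp_eval (μ := fun _ : Fin i => μ) (f := fun y : Unit11 => (y : ℝ))
    measurable_subtype_coe.aestronglyMeasurable

theorem integral_prefixMean (μ : Measure Unit11) [IsProbabilityMeasure μ] {a : ℕ} (ha : 0 < a)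
    (i : ℕ+) (hai : a ≤ i) :
    ∫ x, prefixMean a ⟨i, x⟩ ∂(Measure.pi fun _ : Fin (i : ℕ) => μ) = ∫ y, (y : ℝ) ∂μ := by
  have hint : ∀ u : Fin (i : ℕ), Integrable (fun x : Fin (i : ℕ) → Unit11 => (x u : ℝ))
      (Measure.pi fun _ : Fin (i : ℕ) => μ) := fun u =>
    Integrable.of_mem_Icc (-1) 1
      (measurable_subtype_coe.comp (measurable_pi_apply u)).aemeasurable
      (Filter.Eventually.of_forall fun x => (x u).2)
  simp only [prefixMean_mk]
  rw [integral_div, integral_finsetSum _ fun u _ => hint u]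
  simp only [integral_coe_pi, Finset.sum_const, card_filter_val_lt hai, nsmul_eq_mul]
  field_simp

theorem measureReal_prefixMean_ge_le (μ : Measure Unit11) [IsProbabilityMeasure μ] {a : ℕ}
    (ha : 0 < a) (i : ℕ+) (hai : a ≤ i) {w : ℝ} (hw : 0 ≤ w) :
    (Measure.pi fun _ : Fin (i : ℕ) => μ).real
      {x | w ≤ |prefixMean a ⟨i, x⟩ - ∫ y, (y : ℝ) ∂μ|} ≤ 2 * Real.exp (-(a * w ^ 2 / 2)) := by
  have ha' : (0 : ℝ) < a := by positivity
  have h := measureReal_abs_sum_ge_le (μ := Measure.pi fun _ : Fin (i : ℕ) => μ)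
    (X := fun (u : Fin (i : ℕ)) x => (x u : ℝ)) (fun u => by fun_prop)
    (iIndepFun_pi (X := fun (_ : Fin (i : ℕ)) (y : Unit11) => (y : ℝ))
      fun _ => measurable_subtype_coe.aemeasurable)
    (fun u x => abs_le.2 (x u).2) (Finset.univ.filter fun j => (j : ℕ) < a)
    (ε := a * w) (by positivity)
  have hexp : -(a * w) ^ 2 / (2 * (a : ℝ)) = -(a * w ^ 2 / 2) := by field_simp
  simp only [integral_coe_pi, card_filter_val_lt hai] at h
  rw [hexp] at h
  convert h using 4 with x
  rw [Finset.sum_sub_distrib, Finset.sum_const, card_filter_val_lt hai, nsmul_eq_mul, prefixMean]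
  have : ∀ A B : ℝ, A / a - B = (A - a * B) / a := fun A B => by field_simp
  rw [this, abs_div, abs_of_pos ha', le_div_iff₀ ha', mul_comm]

theorem abs_prefixMean_le (a : ℕ) (x : Dataset) (h : a ≤ x.1) : |prefixMean a x| ≤ 1 := by
  rcases Nat.eq_zero_or_pos a with rfl | ha
  · simp [prefixMean]
  have ha' : (0 : ℝ) < a := by positivity
  rw [prefixMean, abs_div, abs_of_pos ha', div_le_one ha']
  refine (Finset.abs_sum_le_sum_abs _ _).trans ?_
  refine (Finset.sum_le_sum fun j _ => abs_le.2 (x.2 j).2).trans ?_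
  rw [Finset.sum_const, card_filter_val_lt h]
  simp

theorem userLaw_twoPoint (m : ℕ+) (ρ : ℝ) (hρ : ρ ∈ Set.Icc (0 : ℝ) 1) (μ : Measure Unit11) :
    userLaw (twoPoint m ρ hρ) μ =
      ENNReal.ofReal (1 - ρ) • Measure.map (fun x => (⟨1, x⟩ : Dataset)) (Measure.pi fun _ => μ) +
      ENNReal.ofReal ρ • Measure.map (fun x => (⟨m, x⟩ : Dataset)) (Measure.pi fun _ => μ) := by
  refine Measure.ext fun S hS => ?_
  rw [userLaw, Measure.sum_apply _ hS]
  have h : ∀ i : ℕ+, twoPoint m ρ hρ i =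
      (if i = 1 then ENNReal.ofReal (1 - ρ) else 0) + (if i = m then ENNReal.ofReal ρ else 0) :=
    fun _ => rfl
  simp only [h, Measure.smul_apply, Measure.add_apply, smul_eq_mul, add_mul]
  rw [ENNReal.tsum_add]
  simp only [ite_mul, zero_mul]
  rw [tsum_ite_eq, tsum_ite_eq]

theorem integral_userLaw_twoPoint (m : ℕ+) (ρ : ℝ) (hρ : ρ ∈ Set.Icc (0 : ℝ) 1)
    (μ : Measure Unit11) [IsProbabilityMeasure μ] {f : Dataset → ℝ} (hf : Measurable f) {B : ℝ}
    (hB : ∀ x, |f x| ≤ B) :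
    ∫ x, f x ∂(userLaw (twoPoint m ρ hρ) μ) =
      (1 - ρ) * ∫ x, f ⟨1, x⟩ ∂(Measure.pi fun _ => μ) +
        ρ * ∫ x, f ⟨m, x⟩ ∂(Measure.pi fun _ => μ) := by
  have hint : ∀ i : ℕ+, Integrable f
      (Measure.map (fun x : Fin (i : ℕ) → Unit11 => (⟨i, x⟩ : Dataset))
        (Measure.pi fun _ => μ)) := by
    intro i
    have := Measure.isProbabilityMeasure_map (μ := Measure.pi fun _ : Fin (i : ℕ) => μ)
      (measurable_dataset_mk i).aemeasurable
    exact Integrable.of_bound hf.aestronglyMeasurable B (Filter.Eventually.of_forall hB)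
  rw [userLaw_twoPoint, integral_add_measure ((hint 1).smul_measure ENNReal.ofReal_ne_top)
    ((hint m).smul_measure ENNReal.ofReal_ne_top), integral_smul_measure, integral_smul_measure,
    integral_map (measurable_dataset_mk 1).aemeasurable hf.aestronglyMeasurable,
    integral_map (measurable_dataset_mk m).aemeasurable hf.aestronglyMeasurable,
    ENNReal.toReal_ofReal (sub_nonneg.2 hρ.2), ENNReal.toReal_ofReal hρ.1]
  rfl

theorem abs_integral_coe_le (μ : Measure Unit11) [IsProbabilityMeasure μ] :
    |∫ x, (x : ℝ) ∂μ| ≤ 1 := by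
  have := norm_integral_le_of_norm_le_const (μ := μ) (f := fun x : Unit11 => (x : ℝ)) (C := 1)
    (Filter.Eventually.of_forall fun x => abs_le.2 x.2)
  simpa using this

/-! ### The estimator from first samples -/

/-- The value in `[-1, 1]` closest to a real number. -/
noncomputable def clip (x : ℝ) : Unit11 := Set.projIcc (-1) 1 (by norm_num) x

theorem abs_clip_sub_le (x : ℝ) {θ : ℝ} (hθ : |θ| ≤ 1) : |(clip x : ℝ) - θ| ≤ |x - θ| := by
  have h := Set.abs_projIcc_sub_projIcc (a := (-1 : ℝ)) (b := 1) (by norm_num) (c := x) (d := θ)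
  rwa [Set.projIcc_of_mem (x := θ) _ (abs_le.1 hθ)] at h

/-- The bound from the first samples alone. -/
theorem risk_twoPoint_le {n : ℕ} {α : ℝ} (h0 : 0 < α) (h1 : α ≤ 22 / 35) (hn : 0 < n) (m : ℕ+)
    (ρ : ℝ) (hρ : ρ ∈ Set.Icc (0 : ℝ) 1) :
    risk α n (twoPoint m ρ hρ) ≤ ENNReal.ofReal (6 / (n * α ^ 2)) := by
  have hα : 0 < 0.44 * α := by positivity
  have hb : ∀ x : Dataset, |0.44 * α * prefixMean 1 x| ≤ 0.44 * α := fun x => by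
    rw [abs_mul, abs_of_pos hα]
    exact mul_le_of_le_one_right hα.le (abs_prefixMean_le 1 x x.1.pos)
  refine risk_le_of_features h0 h1 (ι := Unit) (t := fun x _ => 0.44 * α * prefixMean 1 x)
    (measurable_pi_lambda _ fun _ => (measurable_prefixMean 1).const_mul _)
    (fun x => by simpa using hb x) (fun z => clip (signMean () z / (0.44 * α)))
    fun μ _ P _ hP => ?_
  have hmean : ∀ i : ℕ+, ∫ x, prefixMean 1 ⟨i, x⟩ ∂(Measure.pi fun _ : Fin (i : ℕ) => μ) =
      ∫ x, (x : ℝ) ∂μ := fun i => integral_prefixMean μ one_pos i i.pos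
  -- The first sample has mean θ for either data set size, so `ρ` cancels.
  have he : ∫ v, sgn (v ()) ∂P = 0.44 * α * ∫ x, (x : ℝ) ∂μ := by
    rw [hP, integral_userLaw_twoPoint m ρ hρ μ ((measurable_prefixMean 1).const_mul _) hb]
    simp only [integral_const_mul, hmean]
    ring
  have hV := integral_signMean_sub_sq_le P hn ()
  calc ∫ z, |(clip (signMean () z / (0.44 * α)) : ℝ) - ∫ x, (x : ℝ) ∂μ| ^ 2
        ∂(Measure.pi fun _ : Fin n => P)
      ≤ ∫ z, ((0.44 * α) ^ 2)⁻¹ * (signMean () z - ∫ v, sgn (v ()) ∂P) ^ 2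
        ∂(Measure.pi fun _ : Fin n => P) := by
        refine integral_mono Integrable.of_finite Integrable.of_finite fun z => ?_
        have h := abs_clip_sub_le (signMean () z / (0.44 * α)) (abs_integral_coe_le μ)
        refine (pow_le_pow_left₀ (abs_nonneg _) h 2).trans ?_
        rw [sq_abs, he]
        apply le_of_eq
        field_simp
    _ ≤ ((0.44 * α) ^ 2)⁻¹ * (1 / n) := by
        rw [integral_const_mul]
        gcongr
    -- Here 1/0.44² < 5.2.
    _ ≤ 6 / (n * α ^ 2) := by
        have : (0 : ℝ) < n := by positivity
        rw [← one_div, div_mul_div_comm, div_le_div_iff₀ (by positivity) (by positivity)]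
        nlinarith [mul_pos this (pow_pos h0 2)]

/-! ### Geometry of the bins -/

/-- The centre of the bin with index `k`, when the real line right of `-1` is cut into bins of
half-width `w`. -/
noncomputable def binCentre (w : ℝ) (k : ℕ) : ℝ := -1 + (2 * k + 1) * w

/-- The indicator of the bin with index `k`. -/
noncomputable def binVote (w : ℝ) (k : ℕ) (y : ℝ) : ℝ :=
  if -w ≤ y - binCentre w k ∧ y - binCentre w k < w then 1 else 0

/-- The normalised offset from the centre of bin `k`, for points of the bin or of its neighbours. -/
noncomputable def binOffset (w : ℝ) (k : ℕ) (y : ℝ) : ℝ :=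
  if |y - binCentre w k| < 3 * w then (y - binCentre w k) / (3 * w) else 0

theorem binVote_nonneg (w : ℝ) (k : ℕ) (y : ℝ) : 0 ≤ binVote w k y := by
  unfold binVote; split_ifs <;> norm_num

theorem binVote_le_one (w : ℝ) (k : ℕ) (y : ℝ) : binVote w k y ≤ 1 := by
  unfold binVote; split_ifs <;> norm_num

theorem measurable_binVote (w : ℝ) (k : ℕ) : Measurable (binVote w k) := by
  unfold binVote
  refine Measurable.ite ?_ measurable_const measurable_const
  have h : Measurable fun y => y - binCentre w k := measurable_id.sub_const _
  exact (measurableSet_le measurable_const h).inter (measurableSet_lt h measurable_const)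

theorem measurable_binOffset (w : ℝ) (k : ℕ) : Measurable (binOffset w k) := by
  unfold binOffset
  refine Measurable.ite ?_ (by fun_prop) measurable_const
  exact measurableSet_lt (by fun_prop) measurable_const

theorem abs_binOffset_le (w : ℝ) (k : ℕ) (y : ℝ) :
    |binOffset w k y| ≤ if |y - binCentre w k| < 3 * w then 1 else 0 := by
  unfold binOffset
  split_ifs with h
  · have : 0 < 3 * w := (abs_nonneg _).trans_lt h
    rw [abs_div, abs_of_pos this, div_le_one this]
    exact h.le
  · simp

/-- A half-open interval of integer length d contains exactly d integers. The bin counts below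
reduce to this because consecutive centres are 2w apart. -/
theorem card_le_of_cast_mem_Ioc {K : ℕ} (A : Finset (Fin K)) (s : ℝ) (d : ℕ)
    (h : ∀ k ∈ A, s < ((k : ℕ) : ℝ) ∧ ((k : ℕ) : ℝ) ≤ s + d) : A.card ≤ d := by
  have hcard : (Finset.Ioc ⌊s⌋ (⌊s⌋ + d)).card = d := by simp
  rw [← hcard]
  refine Finset.card_le_card_of_injOn (fun k => ((k : ℕ) : ℤ)) (fun k hk => ?_) ?_
  · have := h k hk
    simp only [Finset.coe_Ioc, Set.mem_Ioc]
    refine ⟨Int.floor_lt.2 (by exact_mod_cast this.1), ?_⟩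
    rw [← Int.floor_add_natCast]
    exact Int.le_floor.2 (by exact_mod_cast this.2)
  · intro k _ l _ hkl
    exact Fin.ext (Nat.cast_injective (R := ℤ) hkl)

theorem sum_binVote_le {w : ℝ} (hw : 0 < w) (K : ℕ) (y : ℝ) :
    ∑ k : Fin K, binVote w k y ≤ 1 := by
  simp only [binVote, Finset.sum_boole]
  have := card_le_of_cast_mem_Ioc (K := K)
    (Finset.univ.filter fun k : Fin K => -w ≤ y - binCentre w k ∧ y - binCentre w k < w)
    ((y + 1) / (2 * w) - 1) 1 fun k hk => by
      obtain ⟨h1, h2⟩ := (Finset.mem_filter.1 hk).2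
      unfold binCentre at h1 h2
      rw [sub_lt_iff_lt_add, div_lt_iff₀ (by positivity), Nat.cast_one, sub_add_cancel,
        le_div_iff₀ (by positivity)]
      constructor <;> linarith
  exact_mod_cast this

theorem sum_abs_binOffset_le {w : ℝ} (hw : 0 < w) (K : ℕ) (y : ℝ) :
    ∑ k : Fin K, |binOffset w k y| ≤ 3 := by
  refine (Finset.sum_le_sum fun (k : Fin K) _ => abs_binOffset_le w k y).trans ?_
  rw [Finset.sum_boole]
  have := card_le_of_cast_mem_Ioc (K := K)
    (Finset.univ.filter fun k : Fin K => |y - binCentre w k| < 3 * w)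
    ((y + 1) / (2 * w) - 2) 3 fun k hk => by
      obtain ⟨h1, h2⟩ := abs_lt.1 (Finset.mem_filter.1 hk).2
      unfold binCentre at h1 h2
      have h : (y + 1) / (2 * w) - 2 + ((3 : ℕ) : ℝ) = (y + 1) / (2 * w) + 1 := by
        push_cast; ring
      rw [h, sub_lt_iff_lt_add, div_lt_iff₀ (by positivity), ← sub_le_iff_le_add,
        le_div_iff₀ (by positivity)]
      constructor <;> linarith
  exact_mod_cast this

theorem card_near_le {w : ℝ} (hw : 0 < w) (K : ℕ) (θ : ℝ) :
    (Finset.univ.filter fun k : Fin K => |binCentre w k - θ| < 2 * w).card ≤ 2 := by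
  refine card_le_of_cast_mem_Ioc _ ((θ + 1) / (2 * w) - 3 / 2) 2 fun k hk => ?_
  obtain ⟨h1, h2⟩ := abs_lt.1 (Finset.mem_filter.1 hk).2
  unfold binCentre at h1 h2
  have h : (θ + 1) / (2 * w) - 3 / 2 + ((2 : ℕ) : ℝ) = (θ + 1) / (2 * w) + 1 / 2 := by
    push_cast; ring
  rw [h, sub_lt_iff_lt_add, div_lt_iff₀ (by positivity), ← sub_le_iff_le_add,
    le_div_iff₀ (by positivity)]
  constructor <;> linarith

theorem exists_binVote_eq_one {w : ℝ} (hw : 0 < w) {K : ℕ} (hK : 1 / w < K) {y : ℝ}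
    (hy : |y| ≤ 1) : ∃ k : Fin K, binVote w k y = 1 ∧ |binCentre w k - y| ≤ w := by
  obtain ⟨hy1, hy2⟩ := abs_le.1 hy
  have h0 : 0 ≤ (y + 1) / (2 * w) := div_nonneg (by linarith) (by positivity)
  have hle := Nat.floor_le h0
  have hlt := Nat.lt_floor_add_one ((y + 1) / (2 * w))
  rw [le_div_iff₀ (by positivity)] at hle
  rw [div_lt_iff₀ (by positivity)] at hlt
  have hlt' : ⌊(y + 1) / (2 * w)⌋₊ < K := by
    rw [div_lt_iff₀ hw] at hK
    have : (⌊(y + 1) / (2 * w)⌋₊ : ℝ) * w < K * w := by linarith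
    exact_mod_cast lt_of_mul_lt_mul_right this hw.le
  refine ⟨⟨_, hlt'⟩, ?_, ?_⟩
  · rw [binVote, if_pos]
    simp only [binCentre]
    constructor <;> linarith
  · simp only [binCentre]
    rw [abs_le]
    constructor <;> linarith

/-! ### Expected votes and offsets of a concentrated variable -/

section Localisation

variable {Ω : Type*} [MeasurableSpace Ω] {Q : Measure Ω} [IsProbabilityMeasure Q] {Y : Ω → ℝ}
  {θ w δ : ℝ}

theorem integrable_binVote (hY : Measurable Y) (k : ℕ) :
    Integrable (fun ω => binVote w k (Y ω)) Q :=
  Integrable.of_mem_Icc 0 1 ((measurable_binVote w k).comp hY).aemeasurable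
    (Filter.Eventually.of_forall fun _ => ⟨binVote_nonneg _ _ _, binVote_le_one _ _ _⟩)

theorem measurableSet_abs_sub_ge (hY : Measurable Y) : MeasurableSet {ω | w ≤ |Y ω - θ|} :=
  measurableSet_le measurable_const (by fun_prop)

theorem integrable_indicator_abs_sub_ge (hY : Measurable Y) (c : ℝ) :
    Integrable ({ω | w ≤ |Y ω - θ|}.indicator fun _ => c) Q :=
  (integrable_const c).indicator (measurableSet_abs_sub_ge hY)

/-- Such a bin misses the open w-neighbourhood of θ, so it receives a vote only on the deviation
event. -/
theorem integral_binVote_le (hY : Measurable Y) (hδ : Q.real {ω | w ≤ |Y ω - θ|} ≤ δ) {k : ℕ}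
    (hk : 2 * w ≤ |binCentre w k - θ|) : ∫ ω, binVote w k (Y ω) ∂Q ≤ δ := by
  refine le_trans ?_ hδ
  rw [← integral_indicator_one (measurableSet_abs_sub_ge hY)]
  refine integral_mono (integrable_binVote hY k) (integrable_indicator_abs_sub_ge hY 1) fun ω => ?_
  by_cases hω : w ≤ |Y ω - θ|
  · rw [Set.indicator_of_mem (by exact hω)]
    exact binVote_le_one _ _ _
  · rw [Set.indicator_of_notMem (by exact hω), binVote, if_neg]
    rintro ⟨h1, h2⟩
    obtain ⟨h3, h4⟩ := abs_lt.1 (not_le.1 hω)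
    rcases le_abs.1 hk with h | h <;> linarith

/-- Off the deviation event the vote goes to a bin with centre less than 2w from θ. There are at
most two of these, so one gets half of the mass 1 - δ. -/
theorem exists_le_integral_binVote (hY : Measurable Y) (hb : ∀ ω, |Y ω| ≤ 1) (hw : 0 < w)
    (hδ : Q.real {ω | w ≤ |Y ω - θ|} ≤ δ) (hδ1 : δ < 1) {K : ℕ} (hK : 1 / w < K) :
    ∃ k : Fin K, (1 - δ) / 2 ≤ ∫ ω, binVote w k (Y ω) ∂Q := by
  set A := Finset.univ.filter fun k : Fin K => |binCentre w k - θ| < 2 * w with hA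
  have hsum : 1 - δ ≤ ∑ k ∈ A, ∫ ω, binVote w k (Y ω) ∂Q := by
    rw [← integral_finsetSum _ fun (k : Fin K) _ => integrable_binVote hY k]
    have h1 : 1 - Q.real {ω | w ≤ |Y ω - θ|} =
        ∫ ω, (1 - {ω | w ≤ |Y ω - θ|}.indicator (fun _ => (1 : ℝ)) ω) ∂Q := by
      rw [integral_sub (integrable_const _) (integrable_indicator_abs_sub_ge hY 1)]
      have := integral_indicator_one (μ := Q) (measurableSet_abs_sub_ge (w := w) (θ := θ) hY)
      simp only [Pi.one_def] at this
      rw [this]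
      simp
    refine (sub_le_sub_left hδ 1).trans (h1.le.trans ?_)
    refine integral_mono ((integrable_const _).sub (integrable_indicator_abs_sub_ge hY 1))
      (integrable_finsetSum _ fun (k : Fin K) _ => integrable_binVote hY k) fun ω => ?_
    by_cases hω : w ≤ |Y ω - θ|
    · simp only [Set.indicator_of_mem (show ω ∈ {ω | w ≤ |Y ω - θ|} from hω), sub_self]
      exact Finset.sum_nonneg fun k _ => binVote_nonneg _ _ _
    · simp only [Set.indicator_of_notMem (show ω ∉ {ω | w ≤ |Y ω - θ|} from hω), sub_zero]
      obtain ⟨k, hk1, hk2⟩ := exists_binVote_eq_one hw hK (hb ω)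
      rw [← hk1]
      refine Finset.single_le_sum (f := fun k : Fin K => binVote w k (Y ω))
        (fun k _ => binVote_nonneg _ _ _) ?_
      rw [hA, Finset.mem_filter]
      refine ⟨Finset.mem_univ _, ?_⟩
      obtain ⟨h1, h2⟩ := abs_le.1 hk2
      obtain ⟨h3, h4⟩ := abs_lt.1 (not_le.1 hω)
      rw [abs_lt]
      constructor <;> linarith
  have hne : A.Nonempty := by
    rw [Finset.nonempty_iff_ne_empty]
    intro h
    rw [h, Finset.sum_empty] at hsum
    linarith
  have hcard : (A.card : ℝ) ≤ 2 := by exact_mod_cast card_near_le hw K θ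
  obtain ⟨k, _, hk⟩ := Finset.exists_le_of_sum_le (f := fun _ => (1 - δ) / 2) hne <| by
    refine le_trans ?_ hsum
    rw [Finset.sum_const, nsmul_eq_mul]
    nlinarith
  exact ⟨k, hk⟩

/-- If |Y - θ| < w then Y is within 3w of the centre, so the offset is not truncated and is exact.
Otherwise the error is at most |Y - θ| + |θ - centre| ≤ 2 + 2w. -/
theorem abs_integral_binOffset_sub_le (hY : Measurable Y) (hb : ∀ ω, |Y ω| ≤ 1)
    (hmean : ∫ ω, Y ω ∂Q = θ) (hθ : |θ| ≤ 1) (hw : 0 < w)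
    (hδ : Q.real {ω | w ≤ |Y ω - θ|} ≤ δ) {k : ℕ} (hk : |binCentre w k - θ| < 2 * w) :
    |3 * w * ∫ ω, binOffset w k (Y ω) ∂Q - (θ - binCentre w k)| ≤ (2 + 2 * w) * δ := by
  have hintY : Integrable Y Q := Integrable.of_mem_Icc (-1) 1 hY.aemeasurable
    (Filter.Eventually.of_forall fun ω => abs_le.1 (hb ω))
  have hintO : Integrable (fun ω => binOffset w k (Y ω)) Q :=
    Integrable.of_bound ((measurable_binOffset w k).comp hY).aestronglyMeasurable 1
      (Filter.Eventually.of_forall fun ω => (abs_binOffset_le w k (Y ω)).trans (by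
        split_ifs <;> norm_num))
  have heq : 3 * w * ∫ ω, binOffset w k (Y ω) ∂Q - (θ - binCentre w k) =
      ∫ ω, (3 * w * binOffset w k (Y ω) - (Y ω - binCentre w k)) ∂Q := by
    have hsub : Integrable (fun ω => Y ω - binCentre w k) Q := hintY.sub (integrable_const _)
    rw [integral_sub (hintO.const_mul _) hsub, integral_const_mul,
      integral_sub hintY (integrable_const _), hmean]
    simp
  have hind : ∫ ω, {ω | w ≤ |Y ω - θ|}.indicator (fun _ => 2 + 2 * w) ω ∂Q =
      (2 + 2 * w) * Q.real {ω | w ≤ |Y ω - θ|} := by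
    rw [integral_indicator_const _ (measurableSet_abs_sub_ge hY), smul_eq_mul, mul_comm]
  rw [heq]
  refine (abs_integral_le_integral_abs).trans (le_trans ?_
    (mul_le_mul_of_nonneg_left hδ (by positivity)))
  rw [← hind]
  refine integral_mono (((hintO.const_mul _).sub (hintY.sub (integrable_const _))).abs)
    (integrable_indicator_abs_sub_ge hY _) fun ω => ?_
  obtain ⟨hk1, hk2⟩ := abs_lt.1 hk
  simp only [binOffset]
  by_cases hω : w ≤ |Y ω - θ|
  · simp only [Set.indicator_of_mem (show ω ∈ {ω | w ≤ |Y ω - θ|} from hω)]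
    split_ifs with h
    · rw [mul_div_cancel₀ _ (by positivity), sub_self, abs_zero]
      positivity
    · obtain ⟨h1, h2⟩ := abs_le.1 (hb ω)
      obtain ⟨h3, h4⟩ := abs_le.1 hθ
      rw [mul_zero, zero_sub, abs_neg, abs_le]
      constructor <;> linarith
  · simp only [Set.indicator_of_notMem (show ω ∉ {ω | w ≤ |Y ω - θ|} from hω)]
    obtain ⟨h3, h4⟩ := abs_lt.1 (not_le.1 hω)
    rw [if_pos (by rw [abs_lt]; constructor <;> linarith), mul_div_cancel₀ _ (by positivity),
      sub_self, abs_zero]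

end Localisation
-- The bin estimator and its risk
/-- The features of a data set with at least `a` samples: a vote for the bin of their mean, and the
offsets of their mean from the centres of the bins close to it. -/
noncomputable def binFeature (α : ℝ) (a : ℕ) (w : ℝ) (K : ℕ) (x : Dataset) : Fin K ⊕ Fin K → ℝ :=
  if a ≤ x.1 then
    Sum.elim (fun k => 0.34 * α * binVote w k (prefixMean a x))
      (fun k => α / 40 * binOffset w k (prefixMean a x))
  else 0

theorem measurable_binFeature (α : ℝ) (a : ℕ) (w : ℝ) (K : ℕ) :
    Measurable (binFeature α a w K) := by
  refine measurable_dataset fun i => ?_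
  have hm := (measurable_prefixMean a).comp (measurable_dataset_mk i)
  by_cases h : a ≤ i
  · simp only [binFeature, h, if_true]
    refine measurable_pi_lambda _ fun k => ?_
    rcases k with k | k
    · exact ((measurable_binVote w k).comp hm).const_mul _
    · exact ((measurable_binOffset w k).comp hm).const_mul _
  · simp only [binFeature, h, if_false]
    exact measurable_const

/-- At most one vote and three offsets are nonzero, and 0.34 + 3/40 = 0.415 ≤ 0.44. -/
theorem sum_abs_binFeature_le {α : ℝ} (h0 : 0 < α) (a : ℕ) {w : ℝ} (hw : 0 < w) (K : ℕ)
    (x : Dataset) : ∑ k, |binFeature α a w K x k| ≤ 0.44 * α := by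
  unfold binFeature
  split_ifs
  · simp only [Fintype.sum_sum_type, Sum.elim_inl, Sum.elim_inr, abs_mul, ← Finset.mul_sum,
      abs_of_nonneg (binVote_nonneg _ _ _), abs_of_pos (show 0 < 0.34 * α by positivity),
      abs_of_pos (show 0 < α / 40 by positivity)]
    have h1 := mul_le_mul_of_nonneg_left (sum_binVote_le hw K (prefixMean a x))
      (show 0 ≤ 0.34 * α by positivity)
    have h2 := mul_le_mul_of_nonneg_left (sum_abs_binOffset_le hw K (prefixMean a x))
      (show 0 ≤ α / 40 by positivity)
    norm_num at h1 h2 ⊢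
    linarith
  · simp only [Pi.zero_apply, abs_zero, Finset.sum_const_zero]
    positivity

theorem abs_binFeature_le {α : ℝ} (h0 : 0 < α) (a : ℕ) {w : ℝ} (hw : 0 < w) (K : ℕ)
    (x : Dataset) (k : Fin K ⊕ Fin K) : |binFeature α a w K x k| ≤ 0.44 * α :=
  (Finset.single_le_sum (f := fun k => |binFeature α a w K x k|) (fun _ _ => abs_nonneg _)
    (Finset.mem_univ k)).trans (sum_abs_binFeature_le h0 a hw K x)

/-- As `2 ≤ a`, data sets of size 1 have zero features, so the signal is attenuated by exactly `ρ`.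
-/
theorem integral_binFeature {α : ℝ} (h0 : 0 < α) {a : ℕ} (ha : 2 ≤ a) {w : ℝ} (hw : 0 < w) (K : ℕ)
    (m : ℕ+) (ham : a ≤ m) (ρ : ℝ) (hρ : ρ ∈ Set.Icc (0 : ℝ) 1) (μ : Measure Unit11)
    [IsProbabilityMeasure μ] (k : Fin K ⊕ Fin K) :
    ∫ x, binFeature α a w K x k ∂(userLaw (twoPoint m ρ hρ) μ) =
      ρ * ∫ x, Sum.elim (fun k : Fin K => 0.34 * α * binVote w k (prefixMean a ⟨m, x⟩))
        (fun k : Fin K => α / 40 * binOffset w k (prefixMean a ⟨m, x⟩)) k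
        ∂(Measure.pi fun _ => μ) := by
  rw [integral_userLaw_twoPoint m ρ hρ μ (f := fun x => binFeature α a w K x k)
    ((measurable_pi_apply k).comp (measurable_binFeature α a w K))
    fun x => abs_binFeature_le h0 a hw K x k]
  have h1 : ¬ a ≤ ((1 : ℕ+) : ℕ) := by
    rw [PNat.one_coe]
    omega
  simp only [binFeature, h1, ham, if_true, if_false, Pi.zero_apply, integral_zero, mul_zero,
    zero_add]

/-- Decoding of the mean from averaged features: the bin with the most votes, corrected by the
average offset from its centre. -/
noncomputable def binDecode {n : ℕ} (α ρ w : ℝ) {K : ℕ}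
    (kmax : (Fin n → Fin K ⊕ Fin K → Bool) → Fin K)
    (z : Fin n → Fin K ⊕ Fin K → Bool) : Unit11 :=
  clip (binCentre w (kmax z) + 3 * w / (α / 40 * ρ) * signMean (Sum.inr (kmax z)) z)

/-- The first term is the largest squared error, 4, times a union bound on the failure of a vote
average. The rest is variance plus squared bias of the offset correction, with one factor 2 from (u
+ v)² ≤ 2u² + 2v² and another from the number of bins near θ. -/
theorem risk_twoPoint_le_of_bins {n : ℕ} {α : ℝ} (h0 : 0 < α) (h1 : α ≤ 22 / 35) (hn : 0 < n)
    (m : ℕ+) {ρ : ℝ} (hρ : ρ ∈ Set.Icc (0 : ℝ) 1) (hρ0 : 0 < ρ) {a : ℕ} (ha : 2 ≤ a) (ham : a ≤ m)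
    {w δ : ℝ} (hw : 0 < w) (hδ : 2 * Real.exp (-(a * w ^ 2 / 2)) ≤ δ) (hδ1 : δ ≤ 1 / 100) {K : ℕ}
    (hK : 1 / w < K) :
    risk α n (twoPoint m ρ hρ) ≤ ENNReal.ofReal
      (4 * (K * (2 * Real.exp (-(n * (0.068 * (α * ρ)) ^ 2 / 2)))) +
        2 * (2 * ((3 * w / (α / 40 * ρ)) ^ 2 * (1 / n) + ((2 + 2 * w) * δ) ^ 2))) := by
  have hKpos : 0 < K := by
    have : (0 : ℝ) < K := lt_trans (by positivity) hK
    exact_mod_cast this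
  have : Nonempty (Fin K) := ⟨⟨0, hKpos⟩⟩
  choose kmax hkmax using fun z : Fin n → Fin K ⊕ Fin K → Bool =>
    Finite.exists_max fun k : Fin K => signMean (Sum.inl k) z
  refine risk_le_of_features h0 h1 (measurable_binFeature α a w K)
    (sum_abs_binFeature_le h0 a hw K) (binDecode α ρ w kmax) fun μ _ P _ hP => ?_
  set θ := ∫ x, (x : ℝ) ∂μ with hθ
  have hθ1 : |θ| ≤ 1 := abs_integral_coe_le μ
  set Y : (Fin (m : ℕ) → Unit11) → ℝ := fun x => prefixMean a ⟨m, x⟩ with hYdef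
  have hY : Measurable Y := (measurable_prefixMean a).comp (measurable_dataset_mk m)
  have hYb : ∀ x, |Y x| ≤ 1 := fun x => abs_prefixMean_le a _ ham
  set Q : Measure (Fin (m : ℕ) → Unit11) := Measure.pi fun _ => μ with hQ
  have hYδ : Q.real {x | w ≤ |Y x - θ|} ≤ δ :=
    (measureReal_prefixMean_ge_le μ (by omega) m ham hw.le).trans hδ
  have hYm : ∫ x, Y x ∂Q = θ := integral_prefixMean μ (by omega) m ham
  set e : Fin K ⊕ Fin K → ℝ := fun k => ∫ v, sgn (v k) ∂P with he
  have hel : ∀ k : Fin K, e (Sum.inl k) = 0.34 * (α * ρ) * ∫ x, binVote w k (Y x) ∂Q := fun k => by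
    rw [he]
    simp only
    rw [hP, integral_binFeature h0 ha hw K m ham ρ hρ μ]
    simp only [Sum.elim_inl, integral_const_mul]
    ring
  have her : ∀ k : Fin K, e (Sum.inr k) = α / 40 * ρ * ∫ x, binOffset w k (Y x) ∂Q := fun k => by
    rw [he]
    simp only
    rw [hP, integral_binFeature h0 ha hw K m ham ρ hρ μ]
    simp only [Sum.elim_inr, integral_const_mul]
    ring
  have hαρ : 0 < α * ρ := by positivity
  set τ := 0.068 * (α * ρ) with hτ
  have hτ0 : 0 < τ := by positivity
  set Pn : Measure (Fin n → Fin K ⊕ Fin K → Bool) := Measure.pi fun _ => P with hPn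
  set F : Set (Fin n → Fin K ⊕ Fin K → Bool) :=
    ⋃ k : Fin K, {z | τ ≤ |signMean (Sum.inl k) z - e (Sum.inl k)|} with hF
  have hFprob : Pn.real F ≤ K * (2 * Real.exp (-(n * τ ^ 2 / 2))) := by
    refine (measureReal_iUnion_fintype_le _).trans ?_
    refine (Finset.sum_le_sum fun k _ =>
      measureReal_signMean_ge_le P hn (Sum.inl k) hτ0.le).trans ?_
    simp
  set A := Finset.univ.filter fun k : Fin K => |binCentre w k - θ| < 2 * w with hA
  -- In units of αρ, some bin has expected vote at least 0.17 · 0.99 and a far bin at most 0.0034.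
  -- The gap exceeds 2 · 0.068, so no far bin can win.
  have hnear : ∀ z ∉ F, kmax z ∈ A := by
    intro z hz
    simp only [hF, Set.mem_iUnion, not_exists, Set.mem_ofPred_eq, not_le] at hz
    obtain ⟨k, hk⟩ := exists_le_integral_binVote hY hYb hw hYδ (by linarith) hK
    have hz1 := abs_lt.1 (hz k)
    have hz2 := abs_lt.1 (hz (kmax z))
    have hle := hkmax z k
    by_contra hnot
    simp only [hA, Finset.mem_filter, Finset.mem_univ, true_and, not_lt] at hnot
    have hfar := integral_binVote_le (Q := Q) hY hYδ hnot
    have h3 := mul_le_mul_of_nonneg_left hk (show 0 ≤ 0.34 * (α * ρ) by positivity)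
    have h4 := mul_le_mul_of_nonneg_left hfar (show 0 ≤ 0.34 * (α * ρ) by positivity)
    rw [← hel] at h3 h4
    have h5 := mul_le_mul_of_nonneg_left hδ1 hαρ.le
    norm_num at h3 h4 hτ
    nlinarith
  set c := 3 * w / (α / 40 * ρ) with hc
  have hc0 : 0 ≤ c := by positivity
  set b := (2 + 2 * w) * δ with hb
  have hbias : ∀ k ∈ A, |binCentre w k + c * e (Sum.inr k) - θ| ≤ b := by
    intro k hk
    have h := abs_integral_binOffset_sub_le (Q := Q) hY hYb hYm hθ1 hw hYδ
      (Finset.mem_filter.1 hk).2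
    convert h using 2
    rw [her, hc]
    field_simp
    ring
  -- The chosen bin depends on the same releases as the offsets. Summing over the at most two near
  -- bins, a deterministic set, avoids conditioning on the choice.
  have hpt : ∀ z, |(binDecode α ρ w kmax z : ℝ) - θ| ^ 2 ≤ F.indicator (fun _ => (4 : ℝ)) z +
      ∑ k ∈ A, 2 * (c ^ 2 * (signMean (Sum.inr k) z - e (Sum.inr k)) ^ 2 + b ^ 2) := by
    intro z
    have hpos : ∀ k ∈ A,
        0 ≤ 2 * (c ^ 2 * (signMean (Sum.inr k) z - e (Sum.inr k)) ^ 2 + b ^ 2) :=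
      fun k _ => by positivity
    by_cases hz : z ∈ F
    · rw [Set.indicator_of_mem hz]
      have h2 : |(binDecode α ρ w kmax z : ℝ) - θ| ≤ 2 := by
        obtain ⟨h3, h4⟩ := (binDecode α ρ w kmax z).2
        obtain ⟨h5, h6⟩ := abs_le.1 hθ1
        rw [abs_le]
        constructor <;> linarith
      have := pow_le_pow_left₀ (abs_nonneg _) h2 2
      linarith [Finset.sum_nonneg hpos]
    · rw [Set.indicator_of_notMem hz, zero_add]
      refine le_trans ?_ (Finset.single_le_sum hpos (hnear z hz))
      have h2 := abs_clip_sub_le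
        (binCentre w (kmax z) + c * signMean (Sum.inr (kmax z)) z) hθ1
      refine (pow_le_pow_left₀ (abs_nonneg _) h2 2).trans ?_
      rw [sq_abs]
      have h3 := pow_le_pow_left₀ (abs_nonneg _) (hbias _ (hnear z hz)) 2
      rw [sq_abs] at h3
      nlinarith [sq_nonneg (c * (signMean (Sum.inr (kmax z)) z - e (Sum.inr (kmax z))) -
        (binCentre w (kmax z) + c * e (Sum.inr (kmax z)) - θ))]
  have hFm : MeasurableSet F := F.toFinite.measurableSet
  calc ∫ z, |(binDecode α ρ w kmax z : ℝ) - θ| ^ 2 ∂Pn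
      ≤ ∫ z, (F.indicator (fun _ => (4 : ℝ)) z +
          ∑ k ∈ A, 2 * (c ^ 2 * (signMean (Sum.inr k) z - e (Sum.inr k)) ^ 2 + b ^ 2)) ∂Pn :=
        integral_mono Integrable.of_finite Integrable.of_finite hpt
    _ = 4 * Pn.real F + ∑ k ∈ A,
          2 * (c ^ 2 * ∫ z, (signMean (Sum.inr k) z - e (Sum.inr k)) ^ 2 ∂Pn + b ^ 2) := by
        rw [integral_add Integrable.of_finite Integrable.of_finite, integral_indicator_const _ hFm,
          integral_finsetSum _ fun _ _ => Integrable.of_finite, smul_eq_mul, mul_comm]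
        congr 1
        refine Finset.sum_congr rfl fun k _ => ?_
        rw [integral_const_mul, integral_add Integrable.of_finite Integrable.of_finite,
          integral_const_mul]
        simp
    _ ≤ 4 * (K * (2 * Real.exp (-(n * τ ^ 2 / 2)))) +
          ∑ k ∈ A, 2 * (c ^ 2 * (1 / n) + b ^ 2) := by
        gcongr with k hk
        exact integral_signMean_sub_sq_le P hn (Sum.inr k)
    _ ≤ _ := by
        rw [Finset.sum_const, nsmul_eq_mul]
        have : (A.card : ℝ) ≤ 2 := by exact_mod_cast card_near_le hw K θ
        gcongr

end UserLDP

/-! ### Choice of parameters and the rates -/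

theorem Real.exp_one_mul_log_le {x : ℝ} (hx : 0 < x) : Real.exp 1 * Real.log x ≤ x := by
  have h := Real.add_one_le_exp (Real.log x - 1)
  rw [Real.exp_sub, Real.exp_log hx, le_div_iff₀ (Real.exp_pos 1)] at h
  linarith

theorem Real.one_le_log_of_eight_le {x : ℝ} (hx : 8 ≤ x) : 1 ≤ Real.log x := by
  rw [Real.le_log_iff_exp_le (by linarith)]
  linarith [Real.exp_one_lt_d9]

theorem Real.log_le_two_mul_sqrt {x : ℝ} (hx : 0 < x) : Real.log x ≤ 2 * √x := by
  have h := Real.log_le_self (Real.sqrt_nonneg x)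
  rw [Real.log_sqrt hx.le] at h
  linarith

namespace UserLDP

theorem phi_eq {n a : ℕ} {α : ℝ} (hN : 1 ≤ n * α ^ 2) (ha : 1 ≤ a) :
    phi n α a = c5 / (n * α ^ 2) *
      Real.log (8 * (a * (n * α ^ 2)) / Real.log (8 * (a * (n * α ^ 2)))) := by
  have ha' : (1 : ℝ) ≤ a := by exact_mod_cast ha
  rw [phi, max_eq_left (one_le_mul_of_one_le_of_one_le ha' hN), c4]

theorem eight_le {n a : ℕ} {α : ℝ} (hN : 1 ≤ n * α ^ 2) (ha : 1 ≤ a) :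
    8 ≤ 8 * (a * (n * α ^ 2)) := by
  have ha' : (1 : ℝ) ≤ a := by exact_mod_cast ha
  linarith [one_le_mul_of_one_le_of_one_le ha' hN]

theorem phi_le_iff {n a : ℕ} {α : ℝ} (hN : 1 ≤ n * α ^ 2) (ha : 1 ≤ a) (r : ℝ) :
    phi n α a ≤ r ↔ Real.exp (-(r * (n * α ^ 2) / c5)) ≤
      Real.log (8 * (a * (n * α ^ 2))) / (8 * (a * (n * α ^ 2))) := by
  have hx := eight_le hN ha
  have hL := Real.one_le_log_of_eight_le hx
  rw [phi_eq hN ha]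
  generalize 8 * (a * (n * α ^ 2)) = x at hx hL
  have hc : 0 < c5 := by norm_num [c5]
  rw [← Real.le_log_iff_exp_le (by positivity), ← inv_div x, Real.log_inv, neg_le_neg_iff,
    le_div_iff₀ hc, div_mul_eq_mul_div, div_le_iff₀ (by linarith), mul_comm c5]

/-- Since x / log x ≥ e, the threshold is at least c₅/N. This keeps log(aN) away from 0 in the final
rate, even for a = 1. -/
theorem c5_le_of_phi_le_one {n a : ℕ} {α : ℝ} (hN : 1 ≤ n * α ^ 2) (ha : 1 ≤ a)
    (h : phi n α a ≤ 1) : c5 ≤ n * α ^ 2 := by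
  have hx := eight_le hN ha
  have hL := Real.one_le_log_of_eight_le hx
  rw [phi_eq hN ha] at h
  generalize 8 * (a * (n * α ^ 2)) = x at hx hL h
  have hc : 0 < c5 := by norm_num [c5]
  have h1 : 1 ≤ Real.log (x / Real.log x) := by
    rw [Real.le_log_iff_exp_le (by positivity), le_div_iff₀ (by positivity)]
    exact Real.exp_one_mul_log_le (by positivity)
  rw [div_mul_eq_mul_div, div_le_one (by linarith)] at h
  nlinarith

/-- The risk when the large data sets are frequent enough for their bin to be found. -/
theorem risk_twoPoint_le_of_phi_le {n : ℕ} {α : ℝ} (h0 : 0 < α) (h1 : α ≤ 22 / 35)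
    (hN : 1 ≤ n * α ^ 2) (m : ℕ+) {ρ : ℝ} (hρ : ρ ∈ Set.Icc (0 : ℝ) 1) (hρ0 : 0 < ρ) {a : ℕ}
    (ha : 2 ≤ a) (ham : a ≤ m) (hφ : phi n α a ≤ ρ ^ 2) :
    risk α n (twoPoint m ρ hρ) ≤ ENNReal.ofReal
      (230500 * (Real.log (8 * (a * (n * α ^ 2))) / (a * (n * α ^ 2) * ρ ^ 2))) := by
  have ha1 : 1 ≤ a := by omega
  have ha2 : (2 : ℝ) ≤ a := by exact_mod_cast ha
  have ha0 : (0 : ℝ) < a := by linarith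
  have hn : 0 < n := by
    rcases Nat.eq_zero_or_pos n with rfl | h
    · norm_num at hN
    · exact h
  have hn' : (0 : ℝ) < n := by positivity
  have hexp := (phi_le_iff hN ha1 _).1 hφ
  have hx8 := eight_le hN ha1
  have hL := Real.one_le_log_of_eight_le hx8
  set N : ℝ := n * α ^ 2 with hNdef
  set x : ℝ := 8 * (a * N) with hx
  set L : ℝ := Real.log x with hLdef
  have hx16 : 16 ≤ x := by nlinarith
  have hN0 : 0 < N := by linarith
  have hx0 : 0 < x := by linarith
  have hL0 : 0 < L := by linarith
  -- Chosen so that a w²/2 = 2 log x, which makes the deviation probability 2/x².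
  set w : ℝ := 2 * √(L / a) with hw
  have hw0 : 0 < w := by positivity
  have hw2 : w ^ 2 = 4 * (L / a) := by
    rw [hw, mul_pow, Real.sq_sqrt (by positivity)]
    norm_num
  set δ : ℝ := 2 / x ^ 2 with hδ
  have hδexp : 2 * Real.exp (-(a * w ^ 2 / 2)) = δ := by
    have : -(a * w ^ 2 / 2) = -(L + L) := by
      rw [hw2]
      field_simp
      ring
    rw [this, Real.exp_neg, Real.exp_add, hLdef, Real.exp_log hx0, hδ]
    field_simp
  have hδ1 : δ ≤ 1 / 100 := by
    rw [hδ, div_le_div_iff₀ (by positivity) (by norm_num)]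
    nlinarith
  refine (risk_twoPoint_le_of_bins h0 h1 hn m hρ hρ0 ha ham hw0 hδexp.le hδ1
    (K := ⌊1 / w⌋₊ + 1) (by push_cast; exact Nat.lt_floor_add_one _)).trans
    (ENNReal.ofReal_le_ofReal ?_)
  have hKle : ((⌊1 / w⌋₊ + 1 : ℕ) : ℝ) ≤ 2 * √a := by
    have h2 : 1 / w ≤ √a := by
      rw [div_le_iff₀ hw0, hw, Real.sqrt_div hL0.le]
      have h3 : 1 ≤ √L := Real.one_le_sqrt.2 hL
      have h4 : 0 < √(a : ℝ) := by positivity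
      field_simp
      linarith
    have h3 : (1 : ℝ) ≤ √a := Real.one_le_sqrt.2 (by linarith)
    have h4 := Nat.floor_le (show 0 ≤ 1 / w by positivity)
    push_cast
    linarith
  -- The constant c₅ enters here: 0.068²/2 = 0.002312 ≥ 2/868.5. The square of L/x leaves one factor
  -- to absorb the number of bins, at most 2√a.
  have hexp2 : Real.exp (-(n * (0.068 * (α * ρ)) ^ 2 / 2)) ≤ (L / x) ^ 2 := by
    calc Real.exp (-(n * (0.068 * (α * ρ)) ^ 2 / 2))
        ≤ Real.exp (-(ρ ^ 2 * N / c5) + -(ρ ^ 2 * N / c5)) := by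
          rw [Real.exp_le_exp]
          have : (n : ℝ) * (0.068 * (α * ρ)) ^ 2 / 2 = 0.002312 * (ρ ^ 2 * N) := by
            rw [hNdef]
            ring
          rw [this, c5]
          have : 0 ≤ ρ ^ 2 * N := by positivity
          rw [div_eq_mul_inv]
          norm_num
          linarith
      _ = Real.exp (-(ρ ^ 2 * N / c5)) ^ 2 := by rw [Real.exp_add, ← pow_two (Real.exp _)]
      _ ≤ (L / x) ^ 2 := pow_le_pow_left₀ (Real.exp_nonneg _) hexp 2
  have hρ2 : ρ ^ 2 ≤ 1 := pow_le_one₀ hρ.1 hρ.2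
  have haL : √(a : ℝ) * L ≤ 2 * x := by
    have h2 : √(a : ℝ) ≤ √x := Real.sqrt_le_sqrt (by nlinarith)
    have h3 := Real.log_le_two_mul_sqrt hx0
    calc √(a : ℝ) * L ≤ √x * (2 * √x) := mul_le_mul h2 h3 hL0.le (Real.sqrt_nonneg _)
      _ = 2 * x := by rw [mul_left_comm, Real.mul_self_sqrt hx0.le]
  have hD : L / (a * N) ≤ L / (a * N * ρ ^ 2) :=
    div_le_div_of_nonneg_left hL0.le (by positivity) (mul_le_of_le_one_right (by positivity) hρ2)
  have hDx : L / (a * N) = 8 * (L / x) := by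
    rw [hx]
    field_simp
  have hvote : 4 * (((⌊1 / w⌋₊ + 1 : ℕ) : ℝ) *
      (2 * Real.exp (-(n * (0.068 * (α * ρ)) ^ 2 / 2)))) ≤ 4 * (L / (a * N)) := by
    calc _ ≤ 4 * (2 * √a * (2 * (L / x) ^ 2)) := by gcongr
      _ = 16 * (√a * L) * L / x ^ 2 := by field_simp; ring
      _ ≤ 16 * (2 * x) * L / x ^ 2 := by gcongr
      _ = 4 * (L / (a * N)) := by rw [hDx]; field_simp; norm_num
  have hvar : 4 * ((3 * w / (α / 40 * ρ)) ^ 2 * (1 / n)) = 230400 * (L / (a * N * ρ ^ 2)) := by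
    rw [div_pow, mul_pow, hw2, hNdef]
    field_simp
    norm_num
  have hbias : 4 * ((2 + 2 * w) * δ) ^ 2 ≤ 80 * (L / (a * N)) := by
    have h2 : (2 + 2 * w) ^ 2 ≤ 8 + 32 * L := by
      have : L / a ≤ L := div_le_self hL0.le (by linarith)
      nlinarith [sq_nonneg (2 - 2 * w)]
    calc 4 * ((2 + 2 * w) * δ) ^ 2 ≤ 4 * ((8 + 32 * L) * δ ^ 2) := by
          rw [mul_pow]
          gcongr
      _ ≤ 4 * ((40 * L) * (4 * (1 / x))) := by
          have h3 : δ ^ 2 ≤ 4 * (1 / x) := by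
            rw [hδ, div_pow, mul_one_div, div_le_div_iff₀ (by positivity) hx0]
            rw [← pow_mul]
            have : x ≤ x ^ (2 * 2) := le_self_pow₀ (by linarith) (by norm_num)
            linarith
          gcongr
          linarith
      _ = 80 * (L / (a * N)) := by
          rw [hDx]
          field_simp
          norm_num
  have hD0 : 0 ≤ L / (a * N * ρ ^ 2) := by positivity
  -- The coefficients add up to 4 + 230400 + 80 ≤ 230500.
  linarith

theorem log_eight_mul_le {y : ℝ} (hy : 2 ≤ y) : Real.log (8 * y) ≤ 4 * Real.log y := by
  have h : (4 : ℝ) * Real.log y = Real.log (y ^ 4) := by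
    rw [Real.log_pow]
    norm_num
  rw [h]
  refine Real.log_le_log (by linarith) ?_
  have : (2 : ℝ) ^ 3 ≤ y ^ 3 := pow_le_pow_left₀ (by norm_num) hy 3
  nlinarith

/-- The rate for the best of the estimators that use the first sample, or the first `a` samples of
the large data sets. -/
theorem risk_twoPoint_le_rate {n : ℕ} {α : ℝ} (h0 : 0 < α) (h1 : α ≤ 22 / 35)
    (hN : 1 ≤ n * α ^ 2) (m : ℕ+) {ρ : ℝ} (hρ : ρ ∈ Set.Icc (0 : ℝ) 1) {a : ℕ}
    (ha : 1 ≤ a) (ham : a ≤ m) (hφ : phi n α a ≤ ρ ^ 2) :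
    risk α n (twoPoint m ρ hρ) ≤ ENNReal.ofReal (3688000 *
      (Real.log (a * n * α ^ 2) / (n * α ^ 2 * ((1 - ρ) + ρ * √(a : ℝ)) ^ 2))) := by
  have hn : 0 < n := by
    rcases Nat.eq_zero_or_pos n with rfl | h
    · norm_num at hN
    · exact h
  have ha1 : (1 : ℝ) ≤ a := by exact_mod_cast ha
  have hρ2 : ρ ^ 2 ≤ 1 := pow_le_one₀ hρ.1 hρ.2
  have hc := c5_le_of_phi_le_one hN ha (hφ.trans hρ2)
  rw [mul_assoc (a : ℝ)]
  have hN2 : 2 ≤ n * α ^ 2 := le_trans (by norm_num [c5]) hc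
  have hy : (2 : ℝ) ≤ a * (n * α ^ 2) := by nlinarith
  have hD0 : 0 < (1 - ρ) + ρ * √(a : ℝ) := by
    have : (1 : ℝ) ≤ √a := Real.one_le_sqrt.2 ha1
    nlinarith [hρ.1]
  have hlog : 1 / 2 ≤ Real.log (a * (n * α ^ 2)) := by
    have := Real.log_le_log (by norm_num) hy
    linarith [Real.log_two_gt_d9]
  -- In the first case (1 - ρ) + ρ√a ≤ 2 and first samples suffice. In the second a ≥ 2 and ρ > 0
  -- are forced, and 1 - ρ ≤ ρ√a.
  by_cases hcase : ρ * √(a : ℝ) ≤ 1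
  · refine (risk_twoPoint_le h0 h1 hn m ρ hρ).trans (ENNReal.ofReal_le_ofReal ?_)
    have hD : ((1 - ρ) + ρ * √(a : ℝ)) ^ 2 ≤ 2 ^ 2 :=
      pow_le_pow_left₀ hD0.le (by linarith [hρ.1]) 2
    have hN0 : 0 < n * α ^ 2 := by linarith
    rw [← mul_div_assoc, div_le_div_iff₀ hN0 (by positivity)]
    have : 6 * ((1 - ρ) + ρ * √(a : ℝ)) ^ 2 ≤ 3688000 * Real.log (a * (n * α ^ 2)) := by linarith
    nlinarith
  · have ha2 : 2 ≤ a := by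
      rcases Nat.lt_or_ge a 2 with h | h
      · have : a = 1 := by omega
        subst this
        exact absurd (by simpa using hρ.2) hcase
      · exact h
    have hρ0 : 0 < ρ := by
      rcases hρ.1.eq_or_lt with h | h
      · rw [← h, zero_mul] at hcase
        norm_num at hcase
      · exact h
    refine (risk_twoPoint_le_of_phi_le h0 h1 hN m hρ hρ0 ha2 ham hφ).trans
      (ENNReal.ofReal_le_ofReal ?_)
    have hD : ((1 - ρ) + ρ * √(a : ℝ)) ^ 2 ≤ 4 * (a * ρ ^ 2) := by
      have h2 : ((1 - ρ) + ρ * √(a : ℝ)) ^ 2 ≤ (2 * (ρ * √(a : ℝ))) ^ 2 :=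
        pow_le_pow_left₀ hD0.le (by linarith [hρ.1]) 2
      rw [mul_pow, mul_pow, Real.sq_sqrt (by linarith)] at h2
      linarith
    have hN0 : 0 < n * α ^ 2 := by linarith
    calc 230500 * (Real.log (8 * (a * (n * α ^ 2))) / (a * (n * α ^ 2) * ρ ^ 2))
        ≤ 230500 * (4 * Real.log (a * (n * α ^ 2)) / (a * (n * α ^ 2) * ρ ^ 2)) := by
          gcongr
          exact log_eight_mul_le hy
      _ = 3688000 * (Real.log (a * (n * α ^ 2)) / (n * α ^ 2 * (4 * (a * ρ ^ 2)))) := by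
          field_simp
          norm_num [mul_comm]
      _ ≤ _ := by
          have : 0 ≤ Real.log (a * (n * α ^ 2)) := by linarith
          gcongr

/-- The rate in terms of the failure probability of the bin search. -/
theorem risk_twoPoint_le_exp {n : ℕ} {α : ℝ} (h0 : 0 < α) (h1 : α ≤ 22 / 35)
    (hN : 1 ≤ n * α ^ 2) (m : ℕ+) {ρ : ℝ} (hρ : ρ ∈ Set.Icc (0 : ℝ) 1) {a : ℕ}
    (ha : 2 ≤ a) (ham : a ≤ m) (hφ : phi n α a ≤ ρ ^ 2) (hφ' : ρ ^ 2 < phi n α (a + 1)) :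
    risk α n (twoPoint m ρ hρ) ≤ ENNReal.ofReal (3688000 *
      (Real.exp (-(ρ ^ 2 * (n * α ^ 2) / c5)) / ρ ^ 2)) := by
  have ha2 : (2 : ℝ) ≤ a := by exact_mod_cast ha
  have hexp := le_of_not_ge fun h =>
    not_le_of_gt hφ' ((phi_le_iff hN (Nat.le_add_left 1 a) (ρ ^ 2)).2 h)
  have hx := eight_le hN (show 1 ≤ a by omega)
  have hL := Real.one_le_log_of_eight_le hx
  -- For ρ = 0 the hypothesis would read 1 ≤ log x / x, which is impossible.
  have hρ0 : 0 < ρ := by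
    rcases hρ.1.eq_or_lt with h | h
    · have h2 := (phi_le_iff hN (show 1 ≤ a by omega) (ρ ^ 2)).1 hφ
      rw [← h] at h2
      norm_num at h2
      rw [one_le_div (by linarith)] at h2
      have h3 := Real.log_le_sub_one_of_pos (show 0 < 8 * (a * (n * α ^ 2)) by linarith)
      linarith
    · exact h
  refine (risk_twoPoint_le_of_phi_le h0 h1 hN m hρ hρ0 ha ham hφ).trans
    (ENNReal.ofReal_le_ofReal ?_)
  have hN0 : 0 < n * α ^ 2 := by linarith
  have ha0 : (0 : ℝ) < a := by linarith
  have hle : (a : ℝ) ≤ (a + 1 : ℕ) := by push_cast; linarith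
  have hle2 : ((a + 1 : ℕ) : ℝ) ≤ 2 * a := by push_cast; linarith
  have ha3 : (0 : ℝ) < (a + 1 : ℕ) := by positivity
  -- Passing to a + 1 ≤ 2a costs a factor 2, and 230500 · 8 · 2 = 3688000.
  calc 230500 * (Real.log (8 * (a * (n * α ^ 2))) / (a * (n * α ^ 2) * ρ ^ 2))
      = 3688000 * (Real.log (8 * (a * (n * α ^ 2))) / (8 * (2 * a * (n * α ^ 2))) / ρ ^ 2) := by
        field_simp
        norm_num
        ring
    _ ≤ 3688000 * (Real.log (8 * ((a + 1 : ℕ) * (n * α ^ 2))) /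
          (8 * ((a + 1 : ℕ) * (n * α ^ 2))) / ρ ^ 2) := by
        have : 0 ≤ Real.log (8 * ((a + 1 : ℕ) * (n * α ^ 2))) :=
          zero_le_one.trans (Real.one_le_log_of_eight_le (eight_le hN (Nat.le_add_left 1 a)))
        gcongr
    _ ≤ _ := by gcongr

end UserLDP

theorem corollary1 :
    ∃ C : ℝ, 0 < C ∧
      ∀ (n : ℕ) (α : ℝ), 0 < α → α ≤ 22 / 35 → 1 ≤ n * α ^ 2 →
      ∀ (m : ℕ+) (ρ : ℝ) (hρ : ρ ∈ Set.Icc (0 : ℝ) 1),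
        (∀ a : ℕ, 1 ≤ a →
          UserLDP.phi n α a =
            UserLDP.c5 * (n * α ^ 2)⁻¹ *
              Real.log (UserLDP.c4 * (a * (n * α ^ 2)) /
                Real.log (UserLDP.c4 * (a * (n * α ^ 2))))) ∧
        UserLDP.risk α n (UserLDP.twoPoint m ρ hρ) ≤
          ENNReal.ofReal (C * (Real.log (UserLDP.c4 * (n * α ^ 2)) / (n * α ^ 2))) ∧
        (UserLDP.phi n α m ≤ ρ ^ 2 →
          UserLDP.risk α n (UserLDP.twoPoint m ρ hρ) ≤
            ENNReal.ofReal (C * (Real.log (m * n * α ^ 2) /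
              (n * α ^ 2 * ((1 - ρ) + ρ * √(m : ℝ)) ^ 2)))) ∧
        (∀ a : ℕ, 2 ≤ a → a + 1 ≤ m →
          UserLDP.phi n α a ≤ ρ ^ 2 → ρ ^ 2 < UserLDP.phi n α (a + 1) →
          UserLDP.risk α n (UserLDP.twoPoint m ρ hρ) ≤
            ENNReal.ofReal (C * min
              (Real.log (a * n * α ^ 2) / (n * α ^ 2 * ((1 - ρ) + ρ * √(a : ℝ)) ^ 2))
              (Real.exp (-(ρ ^ 2 * (n * α ^ 2) / UserLDP.c5)) / ρ ^ 2))) := by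
  -- The constant is 16 · 230500, as needed by both rates: 4 · 4 in the polynomial one, from log(8y)
  -- ≤ 4 log y and ((1 - ρ) + ρ√a)² ≤ 4aρ², and 8 · 2 in the exponential one.
  refine ⟨3688000, by norm_num, fun n α h0 h1 hN m ρ hρ => ⟨fun a ha => ?_, ?_, fun hφ => ?_,
    fun a ha ham hφ hφ' => ?_⟩⟩
  · rw [UserLDP.phi_eq hN ha, UserLDP.c4, div_eq_mul_inv UserLDP.c5]
  · have hn : 0 < n := by
      rcases Nat.eq_zero_or_pos n with rfl | h
      · norm_num at hN
      · exact h
    refine (UserLDP.risk_twoPoint_le h0 h1 hn m ρ hρ).trans (ENNReal.ofReal_le_ofReal ?_)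
    have hL := Real.one_le_log_of_eight_le (show 8 ≤ UserLDP.c4 * (n * α ^ 2) by
      rw [UserLDP.c4]; linarith)
    rw [← mul_div_assoc]
    gcongr
    linarith
  · exact UserLDP.risk_twoPoint_le_rate h0 h1 hN m hρ m.pos le_rfl hφ
  · rw [mul_min_of_nonneg _ _ (by norm_num), ENNReal.ofReal_min]
    exact le_min (UserLDP.risk_twoPoint_le_rate h0 h1 hN m hρ (by omega) (by omega) hφ)
      (UserLDP.risk_twoPoint_le_exp h0 h1 hN m hρ ha (by omega) hφ hφ')
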